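/- **Proposition 1.7 (Chern–Lu type identity).** Let $(M,h)$ be a Hermitian manifold of complex dimension $m$, let $(N,g)$ be a Riemannian manifold of dimension $n$ with Levi-Civita connection coefficients $\Gamma^i_{jk}$, and let $f:M\to N$ be a smooth map. For local holomorphic coordinates $z^\alpha$ on $M$ and local coordinates $y^i$ on $N$ write $f^i_\alpha=\partial f^i/\partial z^\alpha$, $f^i_{\bar\beta}=\partial f^i/\partial\bar z^\beta$, $e_i=f^*(\partial/\partial y^i)$, $h_{\alpha\bar\beta}=h(\partial_\alpha,\bar\partial_\beta)$, and define $h^{\gamma\bar\delta}$ by $\sum_\delta h^{\gamma\bar\delta}h_{\mu\bar\delta}=\delta^\gamma_\mu$. Assume that $f$ is pluri-harmonic, i.e. $\partial_{\mathscr E}\bar\partial f=0$ for $\mathscr E=f^*TN$; in all such coordinates $$\frac{\partial^2 f^i}{\partial z^\alpha\partial\bar z^\beta}+\Gamma^i_{jk}(f)\,f^j_{\bar\beta}f^k_\alpha=0\qquad\text{for all }i,\alpha,\beta .$$ Let $\mathscr F=T^{*1,0}M\otimes f^*TN$ (with $TN$ complexified), with the metric induced by $h$ and $g$, and let $\partial_{\mathscr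 F}$ be the $(1,0)$-part of the connection induced by the Chern connection of $(T^{1,0}M,h)$ and the Levi-Civita connection of $(N,g)$. Let $u=|\partial f|^2=h^{\gamma\bar\delta}g_{ij}f^i_\gamma f^j_{\bar\delta}$. Let $R^M_{\alpha\bar\beta\gamma\bar\delta}=-\dfrac{\partial^2h_{\gamma\bar\delta}}{\partial z^\alpha\partial\bar z^\beta}+h^{\mu\bar\nu}\dfrac{\partial h_{\gamma\bar\nu}}{\partial z^\alpha}\dfrac{\partial h_{\mu\bar\delta}}{\partial\bar z^\beta}$ be the curvature of the Chern connection on $T^{1,0}M$, and let $R^N_{ijk\ell}=g(R(\partial_i,\partial_j)\partial_k,\partial_\ell)$ with $R(X,Y)Z=\nabla_X\nabla_YZ-\nabla_Y\nabla_XZ-\nabla_{[X,Y]}Z$. Then $u$ is a well-defined smooth function on $M$, and in all such coordinates $$\partial\bar\partial u=\langle\partial_{\mathscr F}\partial f,\partial_{\mathscr F}\partial f\rangle+\Big(R^M_{\alpha\bar\beta\gamma\bar\delta}\,h^{\gamma\bar\nu}h^{\mu\bar\delta}g_{ij}f^i_\mu f^j_{\bar\nu}-R^N_{i\ell kj}\,f^i_\alpha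 f^j_{\bar\beta}\big(h^{\gamma\bar\delta}f^k_\gamma f^\ell_{\bar\delta}\big)\Big)\,dz^\alpha\wedge d\bar z^\beta .$$ Here, if $\partial_{\mathscr F}\partial f=D_\alpha f^i_\gamma\,dz^\alpha\otimes(dz^\gamma\otimes e_i)$, then $\langle\partial_{\mathscr F}\partial f,\partial_{\mathscr F}\partial f\rangle=h^{\gamma\bar\delta}g_{ij}\,D_\alpha f^i_\gamma\,\overline{D_\beta f^j_\delta}\;dz^\alpha\wedge d\bar z^\beta$. Moreover, with $\Delta_hu=h^{\alpha\bar\beta}\dfrac{\partial^2u}{\partial z^\alpha\partial\bar z^\beta}$ and $|\partial_{\mathscr F}\partial f|^2=h^{\alpha\bar\beta}h^{\gamma\bar\delta}g_{ij}\,D_\alpha f^i_\gamma\,\overline{D_\beta f^j_\delta}$, $$\Delta_hu=|\partial_{\mathscr F}\partial f|^2+\big(h^{\alpha\bar\beta}R^M_{\alpha\bar\beta\gamma\bar\delta}\big)h^{\gamma\bar\nu}h^{\mu\bar\delta}g_{ij}f^i_\mu f^j_{\bar\nu}-R^N_{i\ell kj}\big(h^{\alpha\bar\beta}f^i_\alpha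 f^j_{\bar\beta}\big)\big(h^{\gamma\bar\delta}f^k_\gamma f^\ell_{\bar\delta}\big).$$ -/

import Mathlib

open scoped Manifold ContDiff ComplexConjugate

noncomputable section

namespace ChernLu

/-- The model space `ℂᵐ`. -/
abbrev CE (m : ℕ) := EuclideanSpace ℂ (Fin m)

/-- The model space `ℝⁿ`. -/
abbrev RE (n : ℕ) := EuclideanSpace ℝ (Fin n)

variable {m n : ℕ}

/-! ### Partial derivatives in coordinates -/

/-- `∂/∂z^α = (∂/∂x^α - i ∂/∂y^α) / 2`, where `z^α = x^α + i y^α`. -/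
def delz (α : Fin m) (φ : CE m → ℂ) (z : CE m) : ℂ :=
  (fderiv ℝ φ z (EuclideanSpace.single α 1)
    - Complex.I * fderiv ℝ φ z (EuclideanSpace.single α Complex.I)) / 2

/-- `∂/∂z̄^α = (∂/∂x^α + i ∂/∂y^α) / 2`. -/
def delzbar (α : Fin m) (φ : CE m → ℂ) (z : CE m) : ℂ :=
  (fderiv ℝ φ z (EuclideanSpace.single α 1)
    + Complex.I * fderiv ℝ φ z (EuclideanSpace.single α Complex.I)) / 2

/-- `∂/∂y^i` on functions of the real coordinates `y¹, …, yⁿ`. -/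
def dely (i : Fin n) (φ : RE n → ℝ) (y : RE n) : ℝ :=
  fderiv ℝ φ y (EuclideanSpace.single i 1)

/-! ### Riemannian geometry in coordinates

`G y` is the matrix `(g_ij)` of a Riemannian metric in the coordinates `y`. -/

/-- Christoffel symbols `Γ^k_{ij}` of the Levi-Civita connection. -/
def christoffel (G : RE n → Matrix (Fin n) (Fin n) ℝ) (k i j : Fin n) (y : RE n) : ℝ :=
  (1 / 2) * ∑ l, (G y)⁻¹ k l *
    (dely i (fun x => G x j l) y + dely j (fun x => G x i l) y - dely l (fun x => G x i j) y)

/-- `R_{ijk}^l`, where `R(∂_i, ∂_j) ∂_k = R_{ijk}^l ∂_l` and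
`R(X,Y)Z = ∇_X ∇_Y Z - ∇_Y ∇_X Z - ∇_{[X,Y]} Z`. -/
def riemannUp (G : RE n → Matrix (Fin n) (Fin n) ℝ) (i j k l : Fin n) (y : RE n) : ℝ :=
  dely i (christoffel G l k j) y - dely j (christoffel G l k i) y
    + ∑ p, (christoffel G p k j y * christoffel G l p i y
        - christoffel G p k i y * christoffel G l p j y)

/-- `R_{ijkl} = g(R(∂_i, ∂_j) ∂_k, ∂_l)`. -/
def riemann (G : RE n → Matrix (Fin n) (Fin n) ℝ) (i j k l : Fin n) (y : RE n) : ℝ :=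
  ∑ s, G y s l * riemannUp G i j k s y

/-! ### Hermitian geometry in coordinates

`H z` is the matrix `(h_{αβ̄})` of a Hermitian metric in the holomorphic coordinates `z`. -/

/-- `h^{γδ̄}`, normalised by `∑_δ h^{γδ̄} h_{μδ̄} = δ^γ_μ`. -/
def hInv (H : CE m → Matrix (Fin m) (Fin m) ℂ) (γ δ : Fin m) (z : CE m) : ℂ :=
  (H z)⁻¹ δ γ

/-- Coefficients of the Chern connection on `T^{1,0}M`:
`∇ ∂_γ = Γ^μ_{αγ} dz^α ⊗ ∂_μ` with `Γ^μ_{αγ} = h^{μν̄} ∂_α h_{γν̄}`. -/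
def chernConn (H : CE m → Matrix (Fin m) (Fin m) ℂ) (μ α γ : Fin m) (z : CE m) : ℂ :=
  ∑ ν, hInv H μ ν z * delz α (fun w => H w γ ν) z

/-- The curvature `R_{αβ̄γδ̄} = h_{μδ̄} R_{αβ̄γ}^μ` of the Chern connection, where
`R(∂_α, ∂̄_β) ∂_γ = R_{αβ̄γ}^μ ∂_μ`, `R_{αβ̄γ}^μ = - ∂Γ^μ_{αγ}/∂z̄^β`. Equivalently
`R_{αβ̄γδ̄} = - ∂²h_{γδ̄}/∂z^α∂z̄^β + h^{μν̄} (∂h_{γν̄}/∂z^α) (∂h_{μδ̄}/∂z̄^β)`. -/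
def chernCurv (H : CE m → Matrix (Fin m) (Fin m) ℂ) (α β γ δ : Fin m) (z : CE m) : ℂ :=
  ∑ μ, H z μ δ * (- delzbar β (chernConn H μ α γ) z)

/-! ### Maps in coordinates

`F : ℂᵐ → ℝⁿ` is the coordinate expression of a map `f : M → N`. Sections of (the complexification
of) `𝓔 = f^* TN` are given by components `s^i`, those of `𝓕 = T^{*1,0}M ⊗ f^* TN` by components
`s^i_γ`. -/

/-- `f^i_α = ∂f^i/∂z^α`. -/
def delF (F : CE m → RE n) (i : Fin n) (α : Fin m) : CE m → ℂ :=
  delz α (fun w => ((F w i : ℝ) : ℂ))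

/-- `f^i_ᾱ = ∂f^i/∂z̄^α`. -/
def delbarF (F : CE m → RE n) (i : Fin n) (α : Fin m) : CE m → ℂ :=
  delzbar α (fun w => ((F w i : ℝ) : ℂ))

/-- The `(1,0)` part of the pull-back connection on `𝓔 = f^* TN`: the coefficient of
`dz^α ⊗ e_i` in `∂_𝓔 (s^i e_i)`. -/
def nablaE (G : RE n → Matrix (Fin n) (Fin n) ℝ) (F : CE m → RE n)
    (s : Fin n → CE m → ℂ) (α : Fin m) (i : Fin n) (z : CE m) : ℂ :=
  delz α (s i) z + ∑ j, ∑ k, (christoffel G i j k (F z) : ℂ) * delF F j α z * s k z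

/-- The `(1,0)` part of the connection on `𝓕 = T^{*1,0}M ⊗ f^* TN` induced by the Chern connection
and the pull-back of the Levi-Civita connection: the coefficient of `dz^α ⊗ (dz^γ ⊗ e_i)` in
`∂_𝓕 (s^i_γ dz^γ ⊗ e_i)`. -/
def nablaF (H : CE m → Matrix (Fin m) (Fin m) ℂ) (G : RE n → Matrix (Fin n) (Fin n) ℝ)
    (F : CE m → RE n) (s : Fin n → Fin m → CE m → ℂ) (α : Fin m) (i : Fin n) (γ : Fin m)
    (z : CE m) : ℂ :=
  nablaE G F (fun k => s k γ) α i z - ∑ δ, chernConn H δ α γ z * s i δ z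

/-- The coefficients of `∂_𝓕 ∂f`. -/
def nablaDelF (H : CE m → Matrix (Fin m) (Fin m) ℂ) (G : RE n → Matrix (Fin n) (Fin n) ℝ)
    (F : CE m → RE n) (α : Fin m) : Fin n → Fin m → CE m → ℂ :=
  nablaF H G F (delF F) α

/-- The Hermitian metric of `𝓕` at the point with coordinates `z`:
`⟨s, t⟩ = h^{γδ̄} g_ij s^i_γ conj (t^j_δ)`. -/
def innerF (H : CE m → Matrix (Fin m) (Fin m) ℂ) (G : RE n → Matrix (Fin n) (Fin n) ℝ)
    (F : CE m → RE n) (s t : Fin n → Fin m → CE m → ℂ) (z : CE m) : ℂ :=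
  ∑ γ, ∑ δ, ∑ i, ∑ j, hInv H γ δ z * (G (F z) i j : ℂ) * s i γ z * conj (t j δ z)

/-- The coefficient of `dz^α ∧ dz̄^β` in `⟨∂_𝓕 ∂f, ∂_𝓕 ∂f⟩`; for `𝓕`-valued forms one has
`⟨φ ⊗ s, ψ ⊗ t⟩ = ⟨s, t⟩ φ ∧ conj ψ`. -/
def gradTerm (H : CE m → Matrix (Fin m) (Fin m) ℂ) (G : RE n → Matrix (Fin n) (Fin n) ℝ)
    (F : CE m → RE n) (α β : Fin m) (z : CE m) : ℂ :=
  innerF H G F (nablaDelF H G F α) (nablaDelF H G F β) z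

/-- `R^M_{αβ̄γδ̄} h^{γν̄} h^{μδ̄} g_ij f^i_μ f^j_ν̄`. -/
def domainCurvTerm (H : CE m → Matrix (Fin m) (Fin m) ℂ) (G : RE n → Matrix (Fin n) (Fin n) ℝ)
    (F : CE m → RE n) (α β : Fin m) (z : CE m) : ℂ :=
  ∑ γ, ∑ δ, ∑ μ, ∑ ν, ∑ i, ∑ j, chernCurv H α β γ δ z * hInv H γ ν z * hInv H μ δ z *
    (G (F z) i j : ℂ) * delF F i μ z * delbarF F j ν z

/-- `R^N_{iℓkj} f^i_α f^j_β̄ (h^{γδ̄} f^k_γ f^ℓ_δ̄)`. -/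
def targetCurvTerm (H : CE m → Matrix (Fin m) (Fin m) ℂ) (G : RE n → Matrix (Fin n) (Fin n) ℝ)
    (F : CE m → RE n) (α β : Fin m) (z : CE m) : ℂ :=
  ∑ i, ∑ l, ∑ k, ∑ j, (riemann G i l k j (F z) : ℂ) * delF F i α z * delbarF F j β z *
    ∑ γ, ∑ δ, hInv H γ δ z * delF F k γ z * delbarF F l δ z

/-! ### Manifolds -/

section Manifold

variable {M : Type*} [TopologicalSpace M] [ChartedSpace (CE m) M]
  {N : Type*} [TopologicalSpace N] [ChartedSpace (RE n) N]

/-- The holomorphic coordinate vector `∂/∂z^α` at the point with coordinates `z`. The complex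
tangent space `T_p M` (with its complex structure `J`) is identified with `T^{1,0}_p M`
by `v ↦ (v - i J v) / 2`. -/
def coordVecM (e : OpenPartialHomeomorph M (CE m)) (α : Fin m) (z : CE m) :
    TangentSpace 𝓘(ℂ, CE m) (e.symm z) :=
  mfderiv 𝓘(ℂ, CE m) 𝓘(ℂ, CE m) e.symm z (EuclideanSpace.single α (1 : ℂ) : CE m)

/-- The coordinate vector `∂/∂y^i` at the point with coordinates `y`. -/
def coordVecN (ψ : OpenPartialHomeomorph N (RE n)) (i : Fin n) (y : RE n) :
    TangentSpace (𝓡 n) (ψ.symm y) :=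
  mfderiv (𝓡 n) (𝓡 n) ψ.symm y (EuclideanSpace.single i (1 : ℝ) : RE n)

variable (m M) in
/-- A smooth Hermitian metric on the holomorphic tangent bundle `T^{1,0}M`, as a family of positive
definite Hermitian forms `h(v, w)`, linear in `v` and conjugate-linear in `w`, whose
components in every holomorphic chart are smooth functions (in the real sense). -/
structure HermitianMetric [IsManifold 𝓘(ℂ, CE m) ω M] where
  form (p : M) : TangentSpace 𝓘(ℂ, CE m) p →ₗ[ℂ] TangentSpace 𝓘(ℂ, CE m) p →ₗ⋆[ℂ] ℂ
  symm (p : M) (v w : TangentSpace 𝓘(ℂ, CE m) p) : conj (form p v w) = form p w v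
  pos (p : M) (v : TangentSpace 𝓘(ℂ, CE m) p) : v ≠ 0 → 0 < (form p v v).re
  smooth (e : OpenPartialHomeomorph M (CE m))
    (he : e ∈ IsManifold.maximalAtlas 𝓘(ℂ, CE m) ω M) (α β : Fin m) :
    ContDiffOn ℝ ∞ (fun z => form (e.symm z) (coordVecM e α z) (coordVecM e β z)) e.target

/-- `h_{αβ̄} = h(∂/∂z^α, ∂/∂z^β)` in the chart `e`. -/
def HermitianMetric.matrix [IsManifold 𝓘(ℂ, CE m) ω M] (h : HermitianMetric m M)
    (e : OpenPartialHomeomorph M (CE m)) (z : CE m) : Matrix (Fin m) (Fin m) ℂ :=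
  Matrix.of fun α β => h.form (e.symm z) (coordVecM e α z) (coordVecM e β z)

variable (n N) in
/-- Smooth Riemannian metrics on `N`. -/
abbrev RiemMetric [IsManifold (𝓡 n) ∞ N] :=
  Bundle.ContMDiffRiemannianMetric (𝓡 n) ∞ (RE n) (fun q : N => TangentSpace (𝓡 n) q)

/-- `g_ij = g(∂/∂y^i, ∂/∂y^j)` in the chart `ψ`. -/
def metricMatrix [IsManifold (𝓡 n) ∞ N] (g : RiemMetric n N)
    (ψ : OpenPartialHomeomorph N (RE n)) (y : RE n) : Matrix (Fin n) (Fin n) ℝ :=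
  Matrix.of fun i j => g.inner (ψ.symm y) (coordVecN ψ i y) (coordVecN ψ j y)

/-- The coordinate expression of `f` in the charts `e` and `ψ`. -/
def localRep (e : OpenPartialHomeomorph M (CE m)) (ψ : OpenPartialHomeomorph N (RE n))
    (f : M → N) (z : CE m) : RE n :=
  ψ (f (e.symm z))

/-- `f` is pluri-harmonic, i.e. `∂_𝓔 ∂̄f = 0`: in all local coordinates
`∂²f^i/∂z^α∂z̄^β + Γ^i_{jk}(f) f^j_α f^k_β̄ = 0`, the coefficient of `dz^α ∧ dz̄^β ⊗ e_i` in
`∂_𝓔 (f^i_β̄ dz̄^β ⊗ e_i)`. -/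
def IsPluriharmonic [IsManifold 𝓘(ℂ, CE m) ω M] [IsManifold (𝓡 n) ∞ N]
    (g : RiemMetric n N) (f : M → N) : Prop :=
  ∀ e ∈ IsManifold.maximalAtlas 𝓘(ℂ, CE m) ω M, ∀ ψ ∈ IsManifold.maximalAtlas (𝓡 n) ∞ N,
    ∀ p ∈ e.source, f p ∈ ψ.source → ∀ (α β : Fin m) (i : Fin n),
      nablaE (metricMatrix g ψ) (localRep e ψ f)
        (fun k => delbarF (localRep e ψ f) k β) α i (e p) = 0

/-- The real differential of `f` at `p`. -/
def realDiff (f : M → N) (p : M) (v : TangentSpace 𝓘(ℂ, CE m) p) : TangentSpace (𝓡 n) (f p) :=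
  mfderiv 𝓘(ℝ, CE m) (𝓡 n) f p (v : TangentSpace 𝓘(ℝ, CE m) p)

/-- The value `⟨a + i b, c + i d⟩ = g(a, c) + g(b, d) + i (g(b, c) - g(a, d))` on `T_q N ⊗ ℂ`
of the Hermitian (linear in the first slot) extension of `g`. -/
def gHerm [IsManifold (𝓡 n) ∞ N] (g : RiemMetric n N) (q : N)
    (a b c d : TangentSpace (𝓡 n) q) : ℂ :=
  ((g.inner q a c + g.inner q b d : ℝ) : ℂ)
    + Complex.I * ((g.inner q b c - g.inner q a d : ℝ) : ℂ)

/-- `⟨∂f(v), ∂f(w)⟩`, where `∂f(v) = df((v - i J v) / 2) = df(v) / 2 + i (- df(J v) / 2)`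
in `T_{f(p)} N ⊗ ℂ`. -/
def delPairing [IsManifold (𝓡 n) ∞ N] (g : RiemMetric n N) (f : M → N) (p : M)
    (v w : TangentSpace 𝓘(ℂ, CE m) p) : ℂ :=
  gHerm g (f p)
    ((1 / 2 : ℝ) • realDiff f p v) (-((1 / 2 : ℝ) • realDiff f p (Complex.I • v)))
    ((1 / 2 : ℝ) • realDiff f p w) (-((1 / 2 : ℝ) • realDiff f p (Complex.I • w)))

/-- The trace `h^{γδ̄} Q(b_γ, b_δ)` of a sesquilinear form `Q` with respect to a Hermitian form
`h`; it does not depend on the basis `b`. -/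
def hermTrace {V : Type*} [AddCommGroup V] [Module ℂ V] (b : Module.Basis (Fin m) ℂ V)
    (h : V →ₗ[ℂ] V →ₗ⋆[ℂ] ℂ) (Q : V → V → ℂ) : ℂ :=
  ∑ γ, ∑ δ, (Matrix.of fun α β => h (b α) (b β))⁻¹ δ γ * Q (b γ) (b δ)

/-- The function `u = |∂f|²` on `M`: the trace with respect to `h` of
`(v, w) ↦ ⟨∂f(v), ∂f(w)⟩`, a real number since both forms are Hermitian. -/
def energy [IsManifold 𝓘(ℂ, CE m) ω M] [IsManifold (𝓡 n) ∞ N] (h : HermitianMetric m M)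
    (g : RiemMetric n N) (f : M → N) (p : M) : ℝ :=
  (hermTrace (V := TangentSpace 𝓘(ℂ, CE m) p)
    (EuclideanSpace.basisFun (Fin m) ℂ).toBasis (h.form p) (delPairing g f p)).re

/-- The value of `dz^α` at `v ∈ T_p M`. -/
def dz (e : OpenPartialHomeomorph M (CE m)) (p : M) (α : Fin m)
    (v : TangentSpace 𝓘(ℂ, CE m) p) : ℂ :=
  let ζ : CE m := mfderiv 𝓘(ℂ, CE m) 𝓘(ℂ, CE m) e p v
  ζ α

/-- The `(1,1)`-form `∑ A_{αβ} dz^α ∧ dz̄^β` at `p`, evaluated at `v, w ∈ T_p M`. -/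
def form11 (e : OpenPartialHomeomorph M (CE m)) (p : M) (A : Fin m → Fin m → ℂ)
    (v w : TangentSpace 𝓘(ℂ, CE m) p) : ℂ :=
  ∑ α, ∑ β, A α β * (dz e p α v * conj (dz e p β w) - dz e p α w * conj (dz e p β v))

/-- `∂²u/∂z^α∂z̄^β` in the chart `e`. -/
def complexHessian (e : OpenPartialHomeomorph M (CE m)) (u : M → ℝ) (α β : Fin m) : CE m → ℂ :=
  delz α (delzbar β (fun w => ((u (e.symm w) : ℝ) : ℂ)))

/-- The `(1,1)`-form `∂∂̄u = (∂²u/∂z^α∂z̄^β) dz^α ∧ dz̄^β` at `p`, in the chart `e`. -/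
def ddbar (e : OpenPartialHomeomorph M (CE m)) (u : M → ℝ) (p : M)
    (v w : TangentSpace 𝓘(ℂ, CE m) p) : ℂ :=
  form11 e p (fun α β => complexHessian e u α β (e p)) v w

/-- The trace `h^{αβ̄} A_{αβ̄}` of a `(1,1)`-form, in coordinates. -/
def tr11 (H : CE m → Matrix (Fin m) (Fin m) ℂ) (A : Fin m → Fin m → CE m → ℂ) (z : CE m) : ℂ :=
  ∑ α, ∑ β, hInv H α β z * A α β z

/-- `Δ_h u = h^{αβ̄} ∂²u/∂z^α∂z̄^β` at `p`, in the chart `e`. -/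
def laplacian [IsManifold 𝓘(ℂ, CE m) ω M] (h : HermitianMetric m M)
    (e : OpenPartialHomeomorph M (CE m)) (u : M → ℝ) (p : M) : ℂ :=
  tr11 (h.matrix e) (complexHessian e u) (e p)

end Manifold

end ChernLu

end

/-!
The form `∂f` is a section of `𝓕 = T^{*1,0}M ⊗ f^*TN` and `u = ⟨∂f, ∂f⟩`. Pluri-harmonicity,
together with the symmetry of the Levi-Civita connection, says exactly that `∂f` is annihilated by
the `(0,1)`-part of the connection of `𝓕`. Differentiating `u` once in the direction `∂/∂z̄^β` and
once in the direction `∂/∂z^α` therefore leaves `⟨∇_α ∂f, ∇_β ∂f⟩` and a commutator of covariant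
derivatives, the curvature of `𝓕` applied to `∂f`. That curvature is the sum of the curvatures of
the two tensor factors. The one of `T^{*1,0}M` gives the term in `R^M`; the one of `f^*TN` is
brought into the stated form by the Bianchi identity and the skew-symmetry of the curvature, because
the commutator `[∇_β̄, ∇_δ̄]` on `f^*TN` kills `∂f`.
-/

noncomputable section

namespace ChernLu

open Matrix
open scoped Kronecker Topology Matrix.Norms.Operator

lemma map_eq_sum_smul_single {𝕜 : Type*} [RCLike 𝕜] {ι : Type*} [Fintype ι] [DecidableEq ι]
    {W : Type*} [AddCommGroup W] [Module 𝕜 W] (L : EuclideanSpace 𝕜 ι →ₗ[𝕜] W)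
    (v : EuclideanSpace 𝕜 ι) : L v = ∑ i, v i • L (EuclideanSpace.single i 1) := by
  conv_lhs => rw [← (EuclideanSpace.basisFun ι 𝕜).sum_repr v]
  simp only [map_sum, map_smul, EuclideanSpace.basisFun_repr, EuclideanSpace.basisFun_apply]

section Calculus

variable {E : Type*} [NormedAddCommGroup E] [NormedSpace ℝ E]

lemma differentiableAt_of_contDiffOn {F : Type*} [NormedAddCommGroup F] [NormedSpace ℝ F]
    {U : Set E} (hU : IsOpen U) {φ : E → F} (hφ : ContDiffOn ℝ ∞ φ U) {z : E} (hz : z ∈ U) :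
    DifferentiableAt ℝ φ z :=
  (hφ.contDiffAt (hU.mem_nhds hz)).differentiableAt (by simp)

lemma contDiffOn_ofReal {U : Set E} {φ : E → ℝ} (hφ : ContDiffOn ℝ ∞ φ U) :
    ContDiffOn ℝ ∞ (fun w => (φ w : ℂ)) U :=
  Complex.ofRealCLM.contDiff.comp_contDiffOn hφ

section Matrix

variable {𝕜 : Type*} [RCLike 𝕜] {ι : Type*} [Fintype ι]

lemma contDiffOn_matrix_iff {A : E → Matrix ι ι 𝕜} {U : Set E} :
    ContDiffOn ℝ ∞ A U ↔ ∀ i j, ContDiffOn ℝ ∞ (fun z => A z i j) U := by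
  let toPi : Matrix ι ι 𝕜 ≃L[ℝ] (ι → ι → 𝕜) :=
    (ofLinearEquiv ℝ : (ι → ι → 𝕜) ≃ₗ[ℝ] Matrix ι ι 𝕜).symm.toContinuousLinearEquiv
  rw [← toPi.comp_contDiffOn_iff, contDiffOn_pi]
  exact forall_congr' fun i => contDiffOn_pi

lemma contDiffOn_matrix_inv [DecidableEq ι] {A : E → Matrix ι ι 𝕜} {U : Set E}
    (hA : ContDiffOn ℝ ∞ A U) (hdet : ∀ z ∈ U, IsUnit (A z).det) :
    ContDiffOn ℝ ∞ (fun z => (A z)⁻¹) U := fun z hz => by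
  simp only [nonsing_inv_eq_ringInverse]
  obtain ⟨u, hu⟩ := (isUnit_iff_isUnit_det (A z)).2 (hdet z hz)
  have hinv : ContDiffAt ℝ ∞ Ring.inverse (A z) := hu ▸ contDiffAt_ringInverse ℝ u
  exact hinv.comp_contDiffWithinAt z (hA z hz)

end Matrix

section ComplexDirection

variable {V W Z : Type*}
  [NormedAddCommGroup V] [NormedSpace ℝ V] [NormedSpace ℂ V]
  [NormedAddCommGroup W] [NormedSpace ℝ W] [NormedSpace ℂ W]
  [NormedAddCommGroup Z] [NormedSpace ℝ Z] [NormedSpace ℂ Z]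

/-- The derivative of `s` in the direction of the complexified vector `X.1 + i X.2`. -/
def cderiv (X : E × E) (s : E → V) (z : E) : V :=
  fderiv ℝ s z X.1 + Complex.I • fderiv ℝ s z X.2

/-- The conjugate of a complexified vector. -/
def conjVec (X : E × E) : E × E := (X.1, -X.2)

lemma cderiv_congr {X : E × E} {s t : E → V} {U : Set E} (hU : IsOpen U)
    (h : ∀ z ∈ U, s z = t z) {z : E} (hz : z ∈ U) : cderiv X s z = cderiv X t z := by
  simp only [cderiv, (Filter.eventuallyEq_of_mem (hU.mem_nhds hz) h).fderiv_eq]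

@[simp] lemma cderiv_const (X : E × E) (c : V) (z : E) : cderiv X (fun _ => c) z = 0 := by
  simp [cderiv]

lemma cderiv_neg (X : E × E) (s : E → V) (z : E) : cderiv X (-s) z = -cderiv X s z := by
  simp only [cderiv, fderiv_neg, _root_.neg_apply, smul_neg]
  abel

lemma cderiv_add {X : E × E} {s t : E → V} {z : E} (hs : DifferentiableAt ℝ s z)
    (ht : DifferentiableAt ℝ t z) :
    cderiv X (fun w => s w + t w) z = cderiv X s z + cderiv X t z := by
  simp only [cderiv, fderiv_fun_add hs ht, _root_.add_apply, smul_add]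
  abel

lemma cderiv_sum {κ : Type*} {I : Finset κ} {X : E × E} {s : κ → E → V} {z : E}
    (hs : ∀ i ∈ I, DifferentiableAt ℝ (s i) z) :
    cderiv X (fun w => ∑ i ∈ I, s i w) z = ∑ i ∈ I, cderiv X (s i) z := by
  simp only [cderiv, fderiv_fun_sum hs, _root_.sum_apply, Finset.smul_sum, Finset.sum_add_distrib]

lemma star_cderiv [StarAddMonoid V] [ContinuousStar V] [StarModule ℝ V] [StarModule ℂ V]
    (X : E × E) {s : E → V} {z : E} (hs : DifferentiableAt ℝ s z) :
    star (cderiv X s z) = cderiv (conjVec X) (fun w => star (s w)) z := by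
  have h : fderiv ℝ (fun w => star (s w)) z =
      ((starL' ℝ : V ≃L[ℝ] V) : V →L[ℝ] V).comp (fderiv ℝ s z) :=
    ((starL' ℝ : V ≃L[ℝ] V) : V →L[ℝ] V).hasFDerivAt.comp z hs.hasFDerivAt |>.fderiv
  simp [cderiv, conjVec, h, star_smul]

lemma contDiffOn_cderiv {U : Set E} (hU : IsOpen U) {s : E → V} (hs : ContDiffOn ℝ ∞ s U)
    (X : E × E) : ContDiffOn ℝ ∞ (cderiv X s) U := by
  have h : ContDiffOn ℝ ∞ (fderiv ℝ s) U := hs.fderiv_of_isOpen hU (by simp)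
  exact (h.clm_apply contDiffOn_const).add ((h.clm_apply contDiffOn_const).const_smul Complex.I)

lemma cderiv_comm {U : Set E} (hU : IsOpen U) {s : E → V} (hs : ContDiffOn ℝ ∞ s U) {z : E}
    (hz : z ∈ U) (X Y : E × E) : cderiv X (cderiv Y s) z = cderiv Y (cderiv X s) z := by
  have hd : DifferentiableAt ℝ (fderiv ℝ s) z :=
    differentiableAt_of_contDiffOn hU (hs.fderiv_of_isOpen hU (by simp)) hz
  have hsymm : IsSymmSndFDerivAt ℝ s z :=
    (hs.contDiffAt (hU.mem_nhds hz)).isSymmSndFDerivAt (by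
      simpa using WithTop.coe_le_coe.2 (le_top : (2 : ℕ∞) ≤ ⊤))
  have hdv (v : E) : DifferentiableAt ℝ (fun w => fderiv ℝ s w v) z :=
    hd.clm_apply (differentiableAt_const v)
  have fderiv_cderiv (X : E × E) (v : E) : fderiv ℝ (cderiv X s) z v =
      fderiv ℝ (fderiv ℝ s) z v X.1 + Complex.I • fderiv ℝ (fderiv ℝ s) z v X.2 := by
    have happly (u : E) : fderiv ℝ (fun w => fderiv ℝ s w u) z v =
        fderiv ℝ (fderiv ℝ s) z v u := by
      simp [fderiv_clm_apply hd (differentiableAt_const u)]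
    have hsplit : cderiv X s = fun w => fderiv ℝ s w X.1 + Complex.I • fderiv ℝ s w X.2 := rfl
    rw [hsplit, fderiv_fun_add (hdv _) ((hdv _).fun_const_smul Complex.I),
      fderiv_fun_const_smul (hdv _)]
    simp [happly]
  rw [cderiv, cderiv, fderiv_cderiv, fderiv_cderiv, fderiv_cderiv, fderiv_cderiv,
    hsymm.eq X.1 Y.1, hsymm.eq X.1 Y.2, hsymm.eq X.2 Y.1, hsymm.eq X.2 Y.2]
  module

variable [IsScalarTower ℝ ℂ V] [IsScalarTower ℝ ℂ W]

lemma cderiv_clm (L : V →L[ℂ] W) {X : E × E} {s : E → V} {z : E}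
    (hs : DifferentiableAt ℝ s z) : cderiv X (fun w => L (s w)) z = L (cderiv X s z) := by
  have h : fderiv ℝ (fun w => L (s w)) z = (L.restrictScalars ℝ).comp (fderiv ℝ s z) :=
    ((L.restrictScalars ℝ).hasFDerivAt.comp z hs.hasFDerivAt).fderiv
  simp [cderiv, h]

lemma cderiv_apply {κ : Type*} [Fintype κ] {s : E → κ → ℂ} {z : E}
    (hs : DifferentiableAt ℝ s z) (X : E × E) (i : κ) :
    cderiv X s z i = cderiv X (fun w => s w i) z :=
  (cderiv_clm (ContinuousLinearMap.proj (R := ℂ) i) hs).symm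

lemma cderiv_entry {ι : Type*} [Fintype ι] {A : E → Matrix ι ι ℂ} {z : E}
    (hA : DifferentiableAt ℝ A z) (X : E × E) (i j : ι) :
    cderiv X A z i j = cderiv X (fun w => A w i j) z :=
  (cderiv_clm (entryLinearMap ℂ ℂ i j : Matrix ι ι ℂ →ₗ[ℂ] ℂ).toContinuousLinearMap hA).symm

lemma cderiv_transpose {ι : Type*} [Fintype ι] {A : E → Matrix ι ι ℂ} {z : E}
    (hA : DifferentiableAt ℝ A z) (X : E × E) :
    cderiv X (fun w => (A w)ᵀ) z = (cderiv X A z)ᵀ :=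
  cderiv_clm ((transposeLinearEquiv ι ι ℂ ℂ).toLinearMap.toContinuousLinearMap) hA

variable [IsScalarTower ℝ ℂ Z] [FiniteDimensional ℝ V] [FiniteDimensional ℝ W]

lemma contDiffOn_bilinear (b : V →ₗ[ℂ] W →ₗ[ℂ] Z) {s : E → V} {t : E → W} {U : Set E}
    (hs : ContDiffOn ℝ ∞ s U) (ht : ContDiffOn ℝ ∞ t U) :
    ContDiffOn ℝ ∞ (fun w => b (s w) (t w)) U :=
  (b.restrictScalars₁₂ ℝ ℝ).toContinuousBilinearMap.isBoundedBilinearMap.contDiff.comp₂_contDiffOn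
    hs ht

lemma cderiv_bilinear (b : V →ₗ[ℂ] W →ₗ[ℂ] Z) {X : E × E} {s : E → V} {t : E → W} {z : E}
    (hs : DifferentiableAt ℝ s z) (ht : DifferentiableAt ℝ t z) :
    cderiv X (fun w => b (s w) (t w)) z = b (cderiv X s z) (t z) + b (s z) (cderiv X t z) := by
  have h (v : E) : fderiv ℝ (fun w => b (s w) (t w)) z v =
      b (fderiv ℝ s z v) (t z) + b (s z) (fderiv ℝ t z v) := by
    have hb : fderiv ℝ (fun w => b (s w) (t w)) z = _ :=
      (b.restrictScalars₁₂ ℝ ℝ).toContinuousBilinearMap.fderiv_of_bilinear hs ht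
    rw [hb]
    simp [add_comm]
  simp only [cderiv, h, map_add, map_smul, LinearMap.smul_apply, LinearMap.add_apply, smul_add]
  abel

end ComplexDirection

end Calculus

section Connection

variable {E : Type*} [NormedAddCommGroup E] [NormedSpace ℝ E]
  {ι κ : Type*} [Fintype ι] [Fintype κ]

section Leibniz

variable {A : E → Matrix ι ι ℂ} {s t : E → ι → ℂ} {U : Set E} {z : E}

lemma contDiffOn_mulVec (hA : ContDiffOn ℝ ∞ A U) (hs : ContDiffOn ℝ ∞ s U) :
    ContDiffOn ℝ ∞ (fun w => A w *ᵥ s w) U :=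
  contDiffOn_bilinear (mulVecBilin ℂ ℂ) hA hs

lemma contDiffOn_dotProduct (hs : ContDiffOn ℝ ∞ s U) (ht : ContDiffOn ℝ ∞ t U) :
    ContDiffOn ℝ ∞ (fun w => s w ⬝ᵥ t w) U :=
  contDiffOn_bilinear (dotProductBilin ℂ ℂ) hs ht

lemma contDiffOn_kronecker {B : E → Matrix κ κ ℂ} (hA : ContDiffOn ℝ ∞ A U)
    (hB : ContDiffOn ℝ ∞ B U) : ContDiffOn ℝ ∞ (fun w => A w ⊗ₖ B w) U :=
  contDiffOn_bilinear (kroneckerBilinear (R := ℂ)) hA hB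

lemma cderiv_mulVec (hA : DifferentiableAt ℝ A z) (hs : DifferentiableAt ℝ s z) (X : E × E) :
    cderiv X (fun w => A w *ᵥ s w) z = cderiv X A z *ᵥ s z + A z *ᵥ cderiv X s z :=
  cderiv_bilinear (mulVecBilin ℂ ℂ) hA hs

lemma cderiv_dotProduct (hs : DifferentiableAt ℝ s z) (ht : DifferentiableAt ℝ t z) (X : E × E) :
    cderiv X (fun w => s w ⬝ᵥ t w) z = cderiv X s z ⬝ᵥ t z + s z ⬝ᵥ cderiv X t z :=
  cderiv_bilinear (dotProductBilin ℂ ℂ) hs ht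

lemma cderiv_matrix_mul {B : E → Matrix ι ι ℂ} (hA : DifferentiableAt ℝ A z)
    (hB : DifferentiableAt ℝ B z) (X : E × E) :
    cderiv X (fun w => A w * B w) z = cderiv X A z * B z + A z * cderiv X B z := by
  classical
  exact cderiv_bilinear (LinearMap.mul ℂ (Matrix ι ι ℂ)) hA hB

lemma cderiv_kronecker {B : E → Matrix κ κ ℂ} (hA : DifferentiableAt ℝ A z)
    (hB : DifferentiableAt ℝ B z) (X : E × E) :
    cderiv X (fun w => A w ⊗ₖ B w) z = cderiv X A z ⊗ₖ B z + A z ⊗ₖ cderiv X B z :=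
  cderiv_bilinear (kroneckerBilinear (R := ℂ)) hA hB

end Leibniz

/-- The covariant derivative, in the direction `X`, of a section of a trivial complex bundle whose
connection form takes the value `A` on `X`. -/
def covDeriv (X : E × E) (A : E → Matrix ι ι ℂ) (s : E → ι → ℂ) (z : E) : ι → ℂ :=
  cderiv X s z + A z *ᵥ s z

/-- The bilinear pairing, with matrix `P`, of the sections of a bundle with those of another one
(for a Hermitian metric: the conjugate bundle). -/
def pairing (P : E → Matrix ι ι ℂ) (s t : E → ι → ℂ) (z : E) : ℂ :=
  s z ⬝ᵥ P z *ᵥ t z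

/-- The pairing `P` is parallel at `z` in the direction `X`, on which the connection forms of the
two bundles take the values `A` and `A'`. -/
def IsCompatible (X : E × E) (A A' P : E → Matrix ι ι ℂ) (z : E) : Prop :=
  cderiv X P z = (A z)ᵀ * P z + P z * A' z

section CovDeriv

variable {A A' P : E → Matrix ι ι ℂ} {s t : E → ι → ℂ} {U : Set E} {z : E} {X Y : E × E}

lemma contDiffOn_covDeriv (hU : IsOpen U) (hA : ContDiffOn ℝ ∞ A U) (hs : ContDiffOn ℝ ∞ s U)
    (X : E × E) : ContDiffOn ℝ ∞ (covDeriv X A s) U :=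
  (contDiffOn_cderiv hU hs X).add (contDiffOn_mulVec hA hs)

lemma contDiffOn_pairing (hP : ContDiffOn ℝ ∞ P U) (hs : ContDiffOn ℝ ∞ s U)
    (ht : ContDiffOn ℝ ∞ t U) : ContDiffOn ℝ ∞ (pairing P s t) U :=
  contDiffOn_dotProduct hs (contDiffOn_mulVec hP ht)

lemma covDeriv_congr (hU : IsOpen U) (h : ∀ z ∈ U, s z = t z) (hz : z ∈ U) :
    covDeriv X A s z = covDeriv X A t z := by
  rw [covDeriv, covDeriv, cderiv_congr hU h hz, h z hz]

lemma covDeriv_zero : covDeriv X A (fun _ => 0) z = 0 := by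
  simp [covDeriv]

lemma cderiv_pairing (hU : IsOpen U) (hP : ContDiffOn ℝ ∞ P U) (hs : ContDiffOn ℝ ∞ s U)
    (ht : ContDiffOn ℝ ∞ t U) (hz : z ∈ U) (hc : IsCompatible X A A' P z) :
    cderiv X (pairing P s t) z =
      pairing P (covDeriv X A s) t z + pairing P s (covDeriv X A' t) z := by
  have hPt := differentiableAt_of_contDiffOn hU (contDiffOn_mulVec hP ht) hz
  rw [IsCompatible] at hc
  change cderiv X (fun w => s w ⬝ᵥ P w *ᵥ t w) z = _
  rw [cderiv_dotProduct (differentiableAt_of_contDiffOn hU hs hz) hPt,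
    cderiv_mulVec (differentiableAt_of_contDiffOn hU hP hz)
      (differentiableAt_of_contDiffOn hU ht hz), hc]
  simp only [pairing, covDeriv, add_mulVec, mulVec_add, dotProduct_add, add_dotProduct,
    ← mulVec_mulVec, dotProduct_mulVec _ (A z)ᵀ, vecMul_transpose]
  ring

variable {B B' : E → Matrix ι ι ℂ}

/-- The curvature `R(X, Y)`, for commuting directions `X` and `Y`, of the connection whose
connection form takes the values `A` on `X` and `B` on `Y`. -/
def curvature (X Y : E × E) (A B : E → Matrix ι ι ℂ) (z : E) : Matrix ι ι ℂ :=
  cderiv X B z - cderiv Y A z + (A z * B z - B z * A z)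

lemma covDeriv_comm (hU : IsOpen U) (hA : ContDiffOn ℝ ∞ A U) (hB : ContDiffOn ℝ ∞ B U)
    (hs : ContDiffOn ℝ ∞ s U) (hz : z ∈ U) :
    covDeriv X A (covDeriv Y B s) z - covDeriv Y B (covDeriv X A s) z =
      curvature X Y A B z *ᵥ s z := by
  have hs' := differentiableAt_of_contDiffOn hU hs hz
  have hleibniz {X Y : E × E} {B : E → Matrix ι ι ℂ} (hB : ContDiffOn ℝ ∞ B U) :
      cderiv X (covDeriv Y B s) z =
        cderiv X (cderiv Y s) z + (cderiv X B z *ᵥ s z + B z *ᵥ cderiv X s z) := by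
    rw [← cderiv_mulVec (differentiableAt_of_contDiffOn hU hB hz) hs']
    exact cderiv_add (differentiableAt_of_contDiffOn hU (contDiffOn_cderiv hU hs Y) hz)
      (differentiableAt_of_contDiffOn hU (contDiffOn_mulVec hB hs) hz)
  change cderiv X (covDeriv Y B s) z + A z *ᵥ covDeriv Y B s z -
    (cderiv Y (covDeriv X A s) z + B z *ᵥ covDeriv X A s z) = _
  rw [hleibniz hA, hleibniz hB, cderiv_comm hU hs hz X Y]
  simp only [covDeriv, curvature, mulVec_add, add_mulVec, sub_mulVec, mulVec_mulVec]
  abel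

lemma curvature_transpose_mul (hU : IsOpen U) (hP : ContDiffOn ℝ ∞ P U)
    (hA : ContDiffOn ℝ ∞ A U) (hA' : ContDiffOn ℝ ∞ A' U) (hB : ContDiffOn ℝ ∞ B U)
    (hB' : ContDiffOn ℝ ∞ B' U) (hX : ∀ z ∈ U, IsCompatible X A A' P z)
    (hY : ∀ z ∈ U, IsCompatible Y B B' P z) (hz : z ∈ U) :
    (curvature X Y A B z)ᵀ * P z = -(P z * curvature X Y A' B' z) := by
  classical
  have hdiff {C : E → Matrix ι ι ℂ} (hC : ContDiffOn ℝ ∞ C U) : DifferentiableAt ℝ C z :=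
    differentiableAt_of_contDiffOn hU hC hz
  have hsecond {X Y : E × E} {A A' : E → Matrix ι ι ℂ} (hA : ContDiffOn ℝ ∞ A U)
      (hA' : ContDiffOn ℝ ∞ A' U) (hc : ∀ z ∈ U, IsCompatible X A A' P z) :
      cderiv Y (cderiv X P) z = (cderiv Y A z)ᵀ * P z + (A z)ᵀ * cderiv Y P z +
        (cderiv Y P z * A' z + P z * cderiv Y A' z) := by
    have hAt : DifferentiableAt ℝ (fun w => (A w)ᵀ) z :=
      ((transposeLinearEquiv ι ι ℝ ℂ).toLinearMap.toContinuousLinearMap).differentiableAt.comp z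
        (hdiff hA)
    rw [cderiv_congr hU hc hz, cderiv_add, cderiv_matrix_mul hAt (hdiff hP),
      cderiv_matrix_mul (hdiff hP) (hdiff hA'), cderiv_transpose (hdiff hA)]
    exacts [hAt.mul (hdiff hP), (hdiff hP).mul (hdiff hA')]
  have hcomm := cderiv_comm hU hP hz X Y
  rw [hsecond hB hB' hY, hsecond hA hA' hX, hX z hz, hY z hz] at hcomm
  rw [← sub_eq_zero, curvature, curvature, ← sub_eq_zero.2 hcomm]
  simp only [transpose_add, transpose_sub, transpose_mul]
  noncomm_ring

/-- The Bochner formula for a section `s` and a conjugate section `t` which are parallel in the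
directions `Y` and `X` respectively, such as a holomorphic section and its conjugate. -/
lemma cderiv_cderiv_pairing (hU : IsOpen U) (hP : ContDiffOn ℝ ∞ P U)
    (hA : ContDiffOn ℝ ∞ A U) (hB : ContDiffOn ℝ ∞ B U) (hs : ContDiffOn ℝ ∞ s U)
    (ht : ContDiffOn ℝ ∞ t U) (hX : ∀ z ∈ U, IsCompatible X A A' P z)
    (hY : ∀ z ∈ U, IsCompatible Y B B' P z) (hsY : ∀ z ∈ U, covDeriv Y B s z = 0)
    (htX : ∀ z ∈ U, covDeriv X A' t z = 0) (hz : z ∈ U) :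
    cderiv X (cderiv Y (pairing P s t)) z = pairing P (covDeriv X A s) (covDeriv Y B' t) z +
      (curvature Y X B A z *ᵥ s z) ⬝ᵥ P z *ᵥ t z := by
  have hfirst : ∀ w ∈ U, cderiv X (pairing P s t) w = pairing P (covDeriv X A s) t w :=
    fun w hw => by
      simp [cderiv_pairing hU hP hs ht hw (hX w hw), pairing, htX w hw]
  have hcurv : covDeriv Y B (covDeriv X A s) z = curvature Y X B A z *ᵥ s z := by
    rw [← covDeriv_comm hU hB hA hs hz, covDeriv_congr hU hsY hz, covDeriv_zero, sub_zero]
  rw [cderiv_comm hU (contDiffOn_pairing hP hs ht) hz, cderiv_congr hU hfirst hz,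
    cderiv_pairing hU hP (contDiffOn_covDeriv hU hA hs X) ht hz (hY z hz), ← hcurv, add_comm]
  rfl

end CovDeriv

section Tensor

variable [DecidableEq ι] [DecidableEq κ] {A A' B B' K : E → Matrix ι ι ℂ}
  {C C' D D' P : E → Matrix κ κ ℂ} {U : Set E} {z : E} {X Y : E × E}

/-- The connection induced on the tensor product of two bundles. -/
def tensorConn (A : E → Matrix ι ι ℂ) (C : E → Matrix κ κ ℂ) (z : E) :
    Matrix (ι × κ) (ι × κ) ℂ :=
  A z ⊗ₖ 1 + 1 ⊗ₖ C z

lemma contDiffOn_tensorConn (hA : ContDiffOn ℝ ∞ A U) (hC : ContDiffOn ℝ ∞ C U) :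
    ContDiffOn ℝ ∞ (tensorConn A C) U :=
  (contDiffOn_kronecker hA contDiffOn_const).add (contDiffOn_kronecker contDiffOn_const hC)

lemma IsCompatible.tensor (hK : DifferentiableAt ℝ K z) (hP : DifferentiableAt ℝ P z)
    (hcK : IsCompatible X A A' K z) (hcP : IsCompatible X C C' P z) :
    IsCompatible X (tensorConn A C) (tensorConn A' C') (fun w => K w ⊗ₖ P w) z := by
  rw [IsCompatible] at hcK hcP ⊢
  simp only [cderiv_kronecker hK hP, hcK, hcP, tensorConn, transpose_add, add_mul, mul_add,
    ← kroneckerMap_transpose, transpose_one, ← mul_kronecker_mul, one_mul, mul_one, add_kronecker,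
    kronecker_add]
  abel

lemma cderiv_tensorConn (hU : IsOpen U) (hA : ContDiffOn ℝ ∞ A U) (hC : ContDiffOn ℝ ∞ C U)
    (hz : z ∈ U) (X : E × E) :
    cderiv X (tensorConn A C) z = cderiv X A z ⊗ₖ 1 + 1 ⊗ₖ cderiv X C z := by
  have hA1 : ContDiffOn ℝ ∞ (fun w => A w ⊗ₖ (1 : Matrix κ κ ℂ)) U :=
    contDiffOn_kronecker hA contDiffOn_const
  have h1C : ContDiffOn ℝ ∞ (fun w => (1 : Matrix ι ι ℂ) ⊗ₖ C w) U :=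
    contDiffOn_kronecker contDiffOn_const hC
  change cderiv X (fun w => A w ⊗ₖ 1 + 1 ⊗ₖ C w) z = _
  rw [cderiv_add (differentiableAt_of_contDiffOn hU hA1 hz)
      (differentiableAt_of_contDiffOn hU h1C hz),
    cderiv_kronecker (differentiableAt_of_contDiffOn hU hA hz) (differentiableAt_const _),
    cderiv_kronecker (differentiableAt_const _) (differentiableAt_of_contDiffOn hU hC hz)]
  simp

lemma curvature_tensorConn (hU : IsOpen U) (hA : ContDiffOn ℝ ∞ A U) (hB : ContDiffOn ℝ ∞ B U)
    (hC : ContDiffOn ℝ ∞ C U) (hD : ContDiffOn ℝ ∞ D U) (hz : z ∈ U) :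
    curvature X Y (tensorConn A C) (tensorConn B D) z =
      curvature X Y A B z ⊗ₖ 1 + 1 ⊗ₖ curvature X Y C D z := by
  have sub_kronecker (A B : Matrix ι ι ℂ) (C : Matrix κ κ ℂ) :
      (A - B) ⊗ₖ C = A ⊗ₖ C - B ⊗ₖ C := by
    ext
    simp [sub_mul]
  have kronecker_sub (A : Matrix ι ι ℂ) (B C : Matrix κ κ ℂ) :
      A ⊗ₖ (B - C) = A ⊗ₖ B - A ⊗ₖ C := by
    ext
    simp [mul_sub]
  rw [curvature, cderiv_tensorConn hU hB hD hz, cderiv_tensorConn hU hA hC hz]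
  simp only [curvature, tensorConn, add_mul, mul_add, ← mul_kronecker_mul, one_mul, mul_one,
    add_kronecker, kronecker_add, sub_kronecker, kronecker_sub]
  abel

end Tensor

end Connection

/-- `A` is the matrix, on the open set `U`, of a smooth nondegenerate metric on a bundle,
pseudo-Riemannian for `𝕜 = ℝ` and pseudo-Hermitian for `𝕜 = ℂ`. -/
structure IsMetricOn {E : Type*} [NormedAddCommGroup E] [NormedSpace ℝ E] {𝕜 : Type*} [RCLike 𝕜]
    {ι : Type*} [Fintype ι] [DecidableEq ι] (A : E → Matrix ι ι 𝕜) (U : Set E) : Prop where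
  isOpen : IsOpen U
  smooth : ContDiffOn ℝ ∞ A U
  isHermitian : ∀ z ∈ U, (A z).IsHermitian
  isUnit_det : ∀ z ∈ U, IsUnit (A z).det

lemma IsMetricOn.mono {E : Type*} [NormedAddCommGroup E] [NormedSpace ℝ E] {𝕜 : Type*} [RCLike 𝕜]
    {ι : Type*} [Fintype ι] [DecidableEq ι] {A : E → Matrix ι ι 𝕜} {U V : Set E}
    (hA : IsMetricOn A U) (hV : IsOpen V) (hVU : V ⊆ U) : IsMetricOn A V where
  isOpen := hV
  smooth := hA.smooth.mono hVU
  isHermitian z hz := hA.isHermitian z (hVU hz)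
  isUnit_det z hz := hA.isUnit_det z (hVU hz)

section LeviCivita

variable {n : ℕ} {G : RE n → Matrix (Fin n) (Fin n) ℝ} {V : Set (RE n)} {y : RE n}

lemma fderiv_single_apply {ι : Type*} [Finite ι] {A : RE n → Matrix ι ι ℝ}
    (hA : DifferentiableAt ℝ A y) (k : Fin n) (i j : ι) :
    fderiv ℝ A y (EuclideanSpace.single k 1) i j = dely k (fun x => A x i j) y := by
  have := Fintype.ofFinite ι
  let entry : Matrix ι ι ℝ →L[ℝ] ℝ :=
    (entryLinearMap ℝ ℝ i j : Matrix ι ι ℝ →ₗ[ℝ] ℝ).toContinuousLinearMap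
  have hentry : fderiv ℝ (fun x => A x i j) y = entry.comp (fderiv ℝ A y) :=
    (entry.hasFDerivAt.comp y hA.hasFDerivAt).fderiv
  rw [dely, hentry]
  rfl

lemma contDiffOn_dely (hV : IsOpen V) {φ : RE n → ℝ} (hφ : ContDiffOn ℝ ∞ φ V) (i : Fin n) :
    ContDiffOn ℝ ∞ (dely i φ) V :=
  (hφ.fderiv_of_isOpen hV (by simp) : ContDiffOn ℝ ∞ (fderiv ℝ φ) V).clm_apply contDiffOn_const

/-- The matrix, in the frame `∂_k`, of the Levi-Civita connection in the direction `∂_j`. -/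
def christoffelMatrix (G : RE n → Matrix (Fin n) (Fin n) ℝ) (j : Fin n) (y : RE n) :
    Matrix (Fin n) (Fin n) ℝ :=
  of fun i k => christoffel G i j k y

/-- The matrix, in the frame `∂_k`, of the curvature endomorphism `R(∂_i, ∂_j)`. -/
def riemannMatrix (G : RE n → Matrix (Fin n) (Fin n) ℝ) (i j : Fin n) (y : RE n) :
    Matrix (Fin n) (Fin n) ℝ :=
  of fun s k => riemannUp G i j k s y

namespace IsMetricOn

lemma metric_symm (hG : IsMetricOn G V) (hy : y ∈ V) (i j : Fin n) : G y i j = G y j i := by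
  simpa using (hG.isHermitian y hy).apply j i

lemma dely_symm (hG : IsMetricOn G V) (hy : y ∈ V) (i j k : Fin n) :
    dely k (fun x => G x i j) y = dely k (fun x => G x j i) y := by
  have hsymm : (fun x => G x i j) =ᶠ[𝓝 y] fun x => G x j i :=
    Filter.eventuallyEq_of_mem (hG.isOpen.mem_nhds hy) fun x hx => hG.metric_symm hx i j
  simp only [dely, hsymm.fderiv_eq]

lemma christoffel_symm (hG : IsMetricOn G V) (hy : y ∈ V) (k i j : Fin n) :
    christoffel G k i j y = christoffel G k j i y := by
  simp only [christoffel, hG.dely_symm hy i j, add_comm (dely i _ y)]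

lemma contDiffOn_christoffelMatrix (hG : IsMetricOn G V) (j : Fin n) :
    ContDiffOn ℝ ∞ (christoffelMatrix G j) V := by
  have hdely (l i j : Fin n) : ContDiffOn ℝ ∞ (dely l fun x => G x i j) V :=
    contDiffOn_dely hG.isOpen (contDiffOn_matrix_iff.1 hG.smooth i j) l
  have hinv := contDiffOn_matrix_iff.1 (contDiffOn_matrix_inv hG.smooth hG.isUnit_det)
  exact contDiffOn_matrix_iff.2 fun i k => contDiffOn_const.mul <| ContDiffOn.sum fun l _ =>
    (hinv i l).mul (((hdely _ _ _).add (hdely _ _ _)).sub (hdely _ _ _))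

lemma mul_christoffelMatrix (hG : IsMetricOn G V) (hy : y ∈ V) (i j k : Fin n) :
    (G y * christoffelMatrix G i y) k j = (1 / 2) * (dely i (fun x => G x j k) y +
      dely j (fun x => G x i k) y - dely k (fun x => G x i j) y) := by
  have hinv : christoffelMatrix G i y = (G y)⁻¹ * of fun l j => (1 / 2) *
      (dely i (fun x => G x j l) y + dely j (fun x => G x i l) y -
        dely l (fun x => G x i j) y) := by
    ext p j
    simp only [christoffelMatrix, christoffel, of_apply, mul_apply, Finset.mul_sum]
    exact Finset.sum_congr rfl fun l _ => by ring
  rw [hinv, mul_nonsing_inv_cancel_left _ _ (hG.isUnit_det y hy), of_apply]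

lemma fderiv_metric (hG : IsMetricOn G V) (hy : y ∈ V) (k : Fin n) :
    fderiv ℝ G y (EuclideanSpace.single k 1) =
      (christoffelMatrix G k y)ᵀ * G y + G y * christoffelMatrix G k y := by
  have hGt : (G y)ᵀ = G y := by simpa using (hG.isHermitian y hy).eq
  have htranspose : (christoffelMatrix G k y)ᵀ * G y = (G y * christoffelMatrix G k y)ᵀ := by
    rw [transpose_mul, hGt]
  ext i j
  rw [fderiv_single_apply (differentiableAt_of_contDiffOn hG.isOpen hG.smooth hy), htranspose,
    Matrix.add_apply, transpose_apply, hG.mul_christoffelMatrix hy, hG.mul_christoffelMatrix hy,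
    hG.dely_symm hy j i, hG.dely_symm hy k j, hG.dely_symm hy k i]
  ring

lemma riemannMatrix_eq (hG : IsMetricOn G V) (hy : y ∈ V) (i j : Fin n) :
    riemannMatrix G i j y =
      fderiv ℝ (christoffelMatrix G j) y (EuclideanSpace.single i 1) -
        fderiv ℝ (christoffelMatrix G i) y (EuclideanSpace.single j 1) +
      (christoffelMatrix G i y * christoffelMatrix G j y -
        christoffelMatrix G j y * christoffelMatrix G i y) := by
  have hdiff (i : Fin n) : DifferentiableAt ℝ (christoffelMatrix G i) y :=
    differentiableAt_of_contDiffOn hG.isOpen (hG.contDiffOn_christoffelMatrix i) hy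
  have hdely (i l k j : Fin n) : dely i (christoffel G l k j) y =
      dely i (fun x => christoffelMatrix G j x l k) y := by
    have hsymm : christoffel G l k j =ᶠ[𝓝 y] fun x => christoffelMatrix G j x l k :=
      Filter.eventuallyEq_of_mem (hG.isOpen.mem_nhds hy) fun x hx => hG.christoffel_symm hx l k j
    simp only [dely, hsymm.fderiv_eq]
  have hquad (i j s k : Fin n) : ∑ p, christoffel G p k j y * christoffel G s p i y =
      (christoffelMatrix G i y * christoffelMatrix G j y) s k :=
    Finset.sum_congr rfl fun p _ => by
      rw [hG.christoffel_symm hy p k, hG.christoffel_symm hy s p, mul_comm]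
      rfl
  ext s k
  rw [Matrix.add_apply, Matrix.sub_apply, Matrix.sub_apply, fderiv_single_apply (hdiff j),
    fderiv_single_apply (hdiff i), ← hdely, ← hdely, ← hquad, ← hquad, ← Finset.sum_sub_distrib]
  rfl

end IsMetricOn

end LeviCivita

section Pullback

variable {E : Type*} [NormedAddCommGroup E] [NormedSpace ℝ E] {n : ℕ}
  {G : RE n → Matrix (Fin n) (Fin n) ℝ} {V : Set (RE n)} {F : E → RE n} {U : Set E} {z : E}

/-- The complexified differential of `F` in the complexified direction `X`, in components. -/
def differential (F : E → RE n) (X : E × E) : E → Fin n → ℂ :=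
  cderiv X fun w i => (F w i : ℂ)

lemma fderiv_ofReal {φ : E → ℝ} (hφ : DifferentiableAt ℝ φ z) (v : E) :
    fderiv ℝ (fun w => (φ w : ℂ)) z v = (fderiv ℝ φ z v : ℂ) :=
  congrArg (· v) (Complex.ofRealCLM.hasFDerivAt.comp z hφ.hasFDerivAt).fderiv

lemma differentiableAt_complexCoords (hF : DifferentiableAt ℝ F z) :
    DifferentiableAt ℝ (fun w i => (F w i : ℂ)) z :=
  differentiableAt_pi.2 fun i =>
    Complex.ofRealCLM.differentiableAt.comp z (differentiableAt_euclidean.1 hF i)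

lemma contDiffOn_complexCoords (hF : ContDiffOn ℝ ∞ F U) :
    ContDiffOn ℝ ∞ (fun w i => (F w i : ℂ)) U :=
  contDiffOn_pi.2 fun i => contDiffOn_ofReal (contDiffOn_euclidean.1 hF i)

lemma contDiffOn_differential (hU : IsOpen U) (hF : ContDiffOn ℝ ∞ F U) (X : E × E) :
    ContDiffOn ℝ ∞ (differential F X) U :=
  contDiffOn_cderiv hU (contDiffOn_complexCoords hF) X

lemma differential_apply (hF : DifferentiableAt ℝ F z) (X : E × E) (i : Fin n) :
    differential F X z i = (fderiv ℝ F z X.1 i : ℂ) + Complex.I * (fderiv ℝ F z X.2 i : ℂ) := by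
  have hcoord : DifferentiableAt ℝ (fun w => F w i) z := differentiableAt_euclidean.1 hF i
  have hproj (v : E) : fderiv ℝ (fun w => F w i) z v = fderiv ℝ F z v i :=
    congrArg (· v) ((EuclideanSpace.proj i : RE n →L[ℝ] ℝ).hasFDerivAt.comp z
      hF.hasFDerivAt).fderiv
  rw [differential, cderiv_apply (differentiableAt_complexCoords hF), cderiv,
    fderiv_ofReal hcoord, fderiv_ofReal hcoord, hproj, hproj, smul_eq_mul]

lemma cderiv_comp {W V : Type*} [NormedAddCommGroup W] [NormedSpace ℝ W] [NormedAddCommGroup V]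
    [NormedSpace ℝ V] [NormedSpace ℂ V] [IsScalarTower ℝ ℂ V] (L : W →L[ℝ] V) {A : RE n → W}
    (hA : DifferentiableAt ℝ A (F z)) (hF : DifferentiableAt ℝ F z) (X : E × E) :
    cderiv X (fun w => L (A (F w))) z =
      ∑ j, differential F X z j • L (fderiv ℝ A (F z) (EuclideanSpace.single j 1)) := by
  have hcomp (v : E) : fderiv ℝ (fun w => L (A (F w))) z v =
      L (fderiv ℝ A (F z) (fderiv ℝ F z v)) :=
    congrArg (· v) (L.hasFDerivAt.comp z (hA.hasFDerivAt.comp z hF.hasFDerivAt)).fderiv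
  have hbasis (v : RE n) : L (fderiv ℝ A (F z) v) =
      ∑ j, (v j : ℂ) • L (fderiv ℝ A (F z) (EuclideanSpace.single j 1)) := by
    refine (map_eq_sum_smul_single (L ∘L fderiv ℝ A (F z)).toLinearMap v).trans ?_
    exact Finset.sum_congr rfl fun j _ => (algebraMap_smul ℂ (v j) _).symm
  rw [cderiv, hcomp, hcomp, hbasis, hbasis (fderiv ℝ F z X.2)]
  simp only [Finset.smul_sum, smul_smul, ← Finset.sum_add_distrib, ← add_smul,
    differential_apply hF]

/-- The complexification of a real matrix. -/
abbrev complexify {ι : Type*} [Fintype ι] [DecidableEq ι] : Matrix ι ι ℝ →ₐ[ℝ] Matrix ι ι ℂ :=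
  Complex.ofRealAm.mapMatrix

section ChainRule

variable {ι : Type*} [Fintype ι] [DecidableEq ι] {A : RE n → Matrix ι ι ℝ}

lemma contDiffOn_complexify_comp (hA : ContDiffOn ℝ ∞ A V) (hF : ContDiffOn ℝ ∞ F U)
    (hFU : Set.MapsTo F U V) : ContDiffOn ℝ ∞ (fun w => complexify (A (F w))) U :=
  (complexify (ι := ι)).toLinearMap.toContinuousLinearMap.contDiff.comp_contDiffOn
    (hA.comp hF hFU)

lemma cderiv_complexify_comp (hA : DifferentiableAt ℝ A (F z)) (hF : DifferentiableAt ℝ F z)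
    (X : E × E) : cderiv X (fun w => complexify (A (F w))) z =
      ∑ j, differential F X z j • complexify (fderiv ℝ A (F z) (EuclideanSpace.single j 1)) :=
  cderiv_comp (complexify (ι := ι)).toLinearMap.toContinuousLinearMap hA hF X

end ChainRule

/-- The pull-back by `F` of the Levi-Civita connection, in the direction `X`. -/
def pullbackConn (G : RE n → Matrix (Fin n) (Fin n) ℝ) (F : E → RE n) (X : E × E) (z : E) :
    Matrix (Fin n) (Fin n) ℂ :=
  ∑ j, differential F X z j • complexify (christoffelMatrix G j (F z))

/-- The pull-back by `F` of the metric of the target. -/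
def pullbackMetric (G : RE n → Matrix (Fin n) (Fin n) ℝ) (F : E → RE n) (z : E) :
    Matrix (Fin n) (Fin n) ℂ :=
  complexify (G (F z))

lemma pullbackConn_mulVec (G : RE n → Matrix (Fin n) (Fin n) ℝ) (X : E × E) (s : Fin n → ℂ)
    (i : Fin n) : (pullbackConn G F X z *ᵥ s) i =
      ∑ j, ∑ k, (christoffel G i j k (F z) : ℂ) * differential F X z j * s k := by
  rw [pullbackConn, sum_mulVec, Finset.sum_apply]
  refine Finset.sum_congr rfl fun j _ => ?_
  rw [smul_mulVec, Pi.smul_apply, smul_eq_mul, mulVec, dotProduct, Finset.mul_sum]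
  refine Finset.sum_congr rfl fun k _ => ?_
  change _ * ((christoffel G i j k (F z) : ℂ) * s k) = _
  ring

namespace IsMetricOn

lemma contDiffOn_pullbackMetric (hG : IsMetricOn G V) (hF : ContDiffOn ℝ ∞ F U)
    (hFU : Set.MapsTo F U V) : ContDiffOn ℝ ∞ (pullbackMetric G F) U :=
  contDiffOn_complexify_comp hG.smooth hF hFU

lemma contDiffOn_pullbackConn (hG : IsMetricOn G V) (hU : IsOpen U) (hF : ContDiffOn ℝ ∞ F U)
    (hFU : Set.MapsTo F U V) (X : E × E) : ContDiffOn ℝ ∞ (pullbackConn G F X) U :=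
  ContDiffOn.sum fun j _ =>
    (contDiffOn_pi.1 (contDiffOn_differential hU hF X) j).smul
      (contDiffOn_complexify_comp (hG.contDiffOn_christoffelMatrix j) hF hFU)

lemma isCompatible_pullback (hG : IsMetricOn G V) (hF : DifferentiableAt ℝ F z) (hz : F z ∈ V)
    (X : E × E) :
    IsCompatible X (pullbackConn G F X) (pullbackConn G F X) (pullbackMetric G F) z := by
  have hchain := cderiv_complexify_comp (differentiableAt_of_contDiffOn hG.isOpen hG.smooth hz) hF X
  refine hchain.trans ?_
  simp only [hG.fderiv_metric hz, pullbackConn, pullbackMetric, map_add, map_mul, transpose_sum,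
    transpose_smul, Finset.sum_mul, Finset.mul_sum, smul_mul_assoc, mul_smul_comm, smul_add,
    Finset.sum_add_distrib]
  rfl

lemma covDeriv_differential_comm (hG : IsMetricOn G V) (hU : IsOpen U) (hF : ContDiffOn ℝ ∞ F U)
    (hFU : Set.MapsTo F U V) (hz : z ∈ U) (X Y : E × E) :
    covDeriv X (pullbackConn G F X) (differential F Y) z =
      covDeriv Y (pullbackConn G F Y) (differential F X) z := by
  have hsymm : pullbackConn G F X z *ᵥ differential F Y z =
      pullbackConn G F Y z *ᵥ differential F X z := by
    ext i
    rw [pullbackConn_mulVec, pullbackConn_mulVec, Finset.sum_comm]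
    refine Finset.sum_congr rfl fun k _ => Finset.sum_congr rfl fun j _ => ?_
    rw [hG.christoffel_symm (hFU hz) i j k]
    ring
  rw [covDeriv, covDeriv, hsymm, differential, differential,
    cderiv_comm hU (contDiffOn_complexCoords hF) hz]

lemma bianchi (hG : IsMetricOn G V) (hU : IsOpen U) (hF : ContDiffOn ℝ ∞ F U)
    (hFU : Set.MapsTo F U V) (hz : z ∈ U) (X Y Z : E × E) :
    curvature X Y (pullbackConn G F X) (pullbackConn G F Y) z *ᵥ differential F Z z +
      curvature Y Z (pullbackConn G F Y) (pullbackConn G F Z) z *ᵥ differential F X z +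
      curvature Z X (pullbackConn G F Z) (pullbackConn G F X) z *ᵥ differential F Y z = 0 := by
  have hconn := hG.contDiffOn_pullbackConn hU hF hFU
  have htorsion (X Y Z : E × E) := covDeriv_congr (X := Z) (A := pullbackConn G F Z) hU
    (fun w hw => hG.covDeriv_differential_comm hU hF hFU hw X Y) hz
  simp only [← covDeriv_comm hU (hconn _) (hconn _) (contDiffOn_differential hU hF _) hz]
  rw [htorsion X Z Y, htorsion Y X Z, htorsion Z Y X]
  abel

lemma cderiv_pullbackConn (hG : IsMetricOn G V) (hU : IsOpen U) (hF : ContDiffOn ℝ ∞ F U)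
    (hFU : Set.MapsTo F U V) (hz : z ∈ U) (X Y : E × E) :
    cderiv X (pullbackConn G F Y) z =
      ∑ j, (cderiv X (differential F Y) z j • complexify (christoffelMatrix G j (F z)) +
        differential F Y z j • ∑ i, differential F X z i • complexify
          (fderiv ℝ (christoffelMatrix G j) (F z) (EuclideanSpace.single i 1))) := by
  have hdF := differentiableAt_of_contDiffOn hU (contDiffOn_differential hU hF Y) hz
  have hΓ (j : Fin n) := hG.contDiffOn_christoffelMatrix j
  have hΓF (j : Fin n) := differentiableAt_of_contDiffOn hU
    (contDiffOn_complexify_comp (hΓ j) hF hFU) hz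
  have hdFj (j : Fin n) : DifferentiableAt ℝ (fun w => differential F Y w j) z :=
    differentiableAt_pi.1 hdF j
  have hproduct (j : Fin n) : cderiv X (fun w =>
      differential F Y w j • complexify (christoffelMatrix G j (F w))) z = _ :=
    cderiv_bilinear (LinearMap.lsmul ℂ (Matrix (Fin n) (Fin n) ℂ)) (hdFj j) (hΓF j)
  refine (cderiv_sum fun j _ => (hdFj j).smul (hΓF j)).trans (Finset.sum_congr rfl fun j _ => ?_)
  refine (hproduct j).trans ?_
  rw [cderiv_apply hdF, cderiv_complexify_comp
    (differentiableAt_of_contDiffOn hG.isOpen (hΓ j) (hFU hz))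
    (differentiableAt_of_contDiffOn hU hF hz)]
  rfl

lemma curvature_pullbackConn (hG : IsMetricOn G V) (hU : IsOpen U) (hF : ContDiffOn ℝ ∞ F U)
    (hFU : Set.MapsTo F U V) (hz : z ∈ U) (X Y : E × E) :
    curvature X Y (pullbackConn G F X) (pullbackConn G F Y) z =
      ∑ i, ∑ j, (differential F X z i * differential F Y z j) •
        complexify (riemannMatrix G i j (F z)) := by
  have hsymm : cderiv X (differential F Y) z = cderiv Y (differential F X) z :=
    cderiv_comm hU (contDiffOn_complexCoords hF) hz X Y
  have hswap (a b : Fin n → ℂ) (T : Fin n → Fin n → Matrix (Fin n) (Fin n) ℂ) :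
      ∑ i, ∑ j, (a i * b j) • T i j = ∑ i, ∑ j, (b i * a j) • T j i := by
    rw [Finset.sum_comm]
    simp only [mul_comm]
  rw [curvature, hG.cderiv_pullbackConn hU hF hFU hz, hG.cderiv_pullbackConn hU hF hFU hz, hsymm]
  simp only [hG.riemannMatrix_eq (hFU hz), pullbackConn, map_add, map_sub, map_mul, smul_add,
    smul_sub, Finset.sum_add_distrib, Finset.sum_sub_distrib, Finset.smul_sum, smul_smul,
    Finset.sum_mul_sum, smul_mul_smul_comm, add_sub_add_left_eq_sub]
  congr 2
  · exact hswap _ _ fun j i =>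
      complexify (fderiv ℝ (christoffelMatrix G j) (F z) (EuclideanSpace.single i 1))
  · exact hswap _ _ fun j i =>
      complexify (christoffelMatrix G j (F z)) * complexify (christoffelMatrix G i (F z))

lemma curvature_pairing (hG : IsMetricOn G V) (hU : IsOpen U) (hF : ContDiffOn ℝ ∞ F U)
    (hFU : Set.MapsTo F U V) (hz : z ∈ U) (X Y : E × E) (s t : Fin n → ℂ) :
    (curvature X Y (pullbackConn G F X) (pullbackConn G F Y) z *ᵥ s) ⬝ᵥ
        pullbackMetric G F z *ᵥ t =
      ∑ i, ∑ j, ∑ k, ∑ l, (riemann G i j k l (F z) : ℂ) * differential F X z i *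
        differential F Y z j * s k * t l := by
  have hlower (i j : Fin n) : (complexify (riemannMatrix G i j (F z)) *ᵥ s) ⬝ᵥ
      pullbackMetric G F z *ᵥ t = ∑ k, ∑ l, (riemann G i j k l (F z) : ℂ) * s k * t l := by
    have hentry (k l : Fin n) :
        ((complexify (riemannMatrix G i j (F z)))ᵀ * pullbackMetric G F z) k l =
          riemann G i j k l (F z) := by
      simp [mul_apply, riemann, riemannMatrix, pullbackMetric, mul_comm]
    rw [dotProduct_mulVec, ← vecMul_transpose, vecMul_vecMul, ← dotProduct_mulVec]
    simp only [dotProduct, mulVec, hentry, Finset.mul_sum]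
    congr! 2
    ring
  rw [hG.curvature_pullbackConn hU hF hFU hz]
  simp only [sum_mulVec, smul_mulVec, sum_dotProduct, smul_dotProduct, hlower, smul_eq_mul,
    Finset.mul_sum]
  congr! 4
  ring

end IsMetricOn

end Pullback

section TensorComponents

variable {ι κ : Type*} [Fintype ι] [Fintype κ]

lemma dotProduct_kronecker_mulVec (K : Matrix ι ι ℂ) (P : Matrix κ κ ℂ) (s t : ι × κ → ℂ) :
    s ⬝ᵥ (K ⊗ₖ P) *ᵥ t =
      ∑ γ, ∑ δ, K γ δ * ((fun i => s (γ, i)) ⬝ᵥ P *ᵥ fun j => t (δ, j)) := by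
  simp only [dotProduct, mulVec, kronecker_apply, Fintype.sum_prod_type, Finset.mul_sum]
  refine Finset.sum_congr rfl fun γ _ => ?_
  rw [Finset.sum_comm]
  congr! 3
  ring

lemma kronecker_one_mulVec [DecidableEq κ] (A : Matrix ι ι ℂ) (s : ι × κ → ℂ) (γ : ι) (i : κ) :
    ((A ⊗ₖ (1 : Matrix κ κ ℂ)) *ᵥ s) (γ, i) = ∑ μ, A γ μ * s (μ, i) := by
  simp [mulVec, dotProduct, Fintype.sum_prod_type, one_apply]

lemma one_kronecker_mulVec [DecidableEq ι] (C : Matrix κ κ ℂ) (s : ι × κ → ℂ) (γ : ι) (i : κ) :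
    (((1 : Matrix ι ι ℂ) ⊗ₖ C) *ᵥ s) (γ, i) = (C *ᵥ fun k => s (γ, k)) i := by
  simp [mulVec, dotProduct, Fintype.sum_prod_type, one_apply]

lemma covDeriv_tensorConn [DecidableEq ι] [DecidableEq κ] {E : Type*} [NormedAddCommGroup E]
    [NormedSpace ℝ E] {X : E × E} {s : E → ι × κ → ℂ} {z : E} (A : E → Matrix ι ι ℂ)
    (C : E → Matrix κ κ ℂ) (hs : DifferentiableAt ℝ s z) (γ : ι) (i : κ) :
    covDeriv X (tensorConn A C) s z (γ, i) =
      covDeriv X C (fun w k => s w (γ, k)) z i + ∑ μ, A z γ μ * s z (μ, i) := by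
  have hrow : DifferentiableAt ℝ (fun w k => s w (γ, k)) z :=
    differentiableAt_pi.2 fun k => differentiableAt_pi.1 hs (γ, k)
  simp only [covDeriv, tensorConn, add_mulVec, Pi.add_apply, kronecker_one_mulVec,
    one_kronecker_mulVec, cderiv_apply hs, cderiv_apply hrow]
  ring

end TensorComponents

section Chern

variable {E : Type*} [NormedAddCommGroup E] [NormedSpace ℝ E] {ι : Type*} [Fintype ι]
  [DecidableEq ι] {H : E → Matrix ι ι ℂ} {U : Set E} {z : E}

/-- The Chern connection form, in the direction `X` of type `(1,0)`, of a Hermitian metric `H`, in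
the row convention `∇ ∂_γ = ∑ μ, chernForm H X γ μ ∂_μ`. That of the conjugate bundle is
obtained from the conjugate metric `Hᵀ`. -/
def chernForm (H : E → Matrix ι ι ℂ) (X : E × E) (z : E) : Matrix ι ι ℂ :=
  cderiv X H z * (H z)⁻¹

/-- The metric `h^{γδ̄}` induced by the Hermitian metric `H` on the dual bundle. -/
def dualMetric (H : E → Matrix ι ι ℂ) (z : E) : Matrix ι ι ℂ :=
  ((H z)⁻¹)ᵀ

namespace IsMetricOn

lemma transpose (hH : IsMetricOn H U) : IsMetricOn (fun w => (H w)ᵀ) U where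
  isOpen := hH.isOpen
  smooth := contDiffOn_matrix_iff.2 fun i j => contDiffOn_matrix_iff.1 hH.smooth j i
  isHermitian z hz := (hH.isHermitian z hz).transpose
  isUnit_det z hz := by simpa using hH.isUnit_det z hz

lemma contDiffOn_inv (hH : IsMetricOn H U) : ContDiffOn ℝ ∞ (fun w => (H w)⁻¹) U :=
  contDiffOn_matrix_inv hH.smooth hH.isUnit_det

lemma contDiffOn_chernForm (hH : IsMetricOn H U) (X : E × E) :
    ContDiffOn ℝ ∞ (chernForm H X) U :=
  (contDiffOn_cderiv hH.isOpen hH.smooth X).mul hH.contDiffOn_inv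

lemma contDiffOn_dualMetric (hH : IsMetricOn H U) : ContDiffOn ℝ ∞ (dualMetric H) U :=
  contDiffOn_matrix_iff.2 fun i j => contDiffOn_matrix_iff.1 hH.contDiffOn_inv j i

lemma cderiv_inv (hH : IsMetricOn H U) (hz : z ∈ U) (X : E × E) :
    cderiv X (fun w => (H w)⁻¹) z = -((H z)⁻¹ * cderiv X H z * (H z)⁻¹) := by
  have hmul : ∀ w ∈ U, H w * (H w)⁻¹ = 1 := fun w hw => mul_nonsing_inv _ (hH.isUnit_det w hw)
  have hproduct := cderiv_congr (X := X) hH.isOpen hmul hz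
  rw [cderiv_const, cderiv_matrix_mul (differentiableAt_of_contDiffOn hH.isOpen hH.smooth hz)
    (differentiableAt_of_contDiffOn hH.isOpen hH.contDiffOn_inv hz)] at hproduct
  rw [mul_assoc, eq_neg_of_add_eq_zero_left hproduct, mul_neg, neg_neg, ← mul_assoc,
    nonsing_inv_mul _ (hH.isUnit_det z hz), one_mul]

lemma cderiv_dualMetric (hH : IsMetricOn H U) (hz : z ∈ U) (X : E × E) :
    cderiv X (dualMetric H) z = -((H z)⁻¹ * cderiv X H z * (H z)⁻¹)ᵀ := by
  rw [← transpose_neg, ← hH.cderiv_inv hz]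
  exact cderiv_transpose (differentiableAt_of_contDiffOn hH.isOpen hH.contDiffOn_inv hz) X

lemma isCompatible_chern (hH : IsMetricOn H U) (hz : z ∈ U) (X : E × E) :
    IsCompatible X (-chernForm H X) 0 (dualMetric H) z := by
  simp [IsCompatible, hH.cderiv_dualMetric hz, chernForm, dualMetric, Matrix.mul_assoc]

lemma isCompatible_chern_conj (hH : IsMetricOn H U) (hz : z ∈ U) (Y : E × E) :
    IsCompatible Y 0 (-chernForm (fun w => (H w)ᵀ) Y) (dualMetric H) z := by
  simp [IsCompatible, hH.cderiv_dualMetric hz, chernForm, dualMetric, Matrix.mul_assoc,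
    transpose_nonsing_inv,
    cderiv_transpose (differentiableAt_of_contDiffOn hH.isOpen hH.smooth hz)]

end IsMetricOn

end Chern

section Bochner

variable {E : Type*} [NormedAddCommGroup E] [NormedSpace ℝ E] {n : ℕ}
  {G : RE n → Matrix (Fin n) (Fin n) ℝ} {V : Set (RE n)} {F : E → RE n} {U : Set E} {z : E}

lemma star_differential (hF : DifferentiableAt ℝ F z) (X : E × E) :
    star (differential F X z) = differential F (conjVec X) z := by
  ext i
  simp [differential_apply hF, conjVec]

lemma star_pullbackConn (hF : DifferentiableAt ℝ F z) (X : E × E) :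
    (pullbackConn G F X z).map star = pullbackConn G F (conjVec X) z := by
  ext i k
  simp [pullbackConn, ← star_differential hF, Matrix.sum_apply]

lemma IsMetricOn.star_chernForm {ι : Type*} [Fintype ι] [DecidableEq ι] {H : E → Matrix ι ι ℂ}
    (hH : IsMetricOn H U) (hz : z ∈ U) (X : E × E) :
    (chernForm H X z).map star = chernForm (fun w => (H w)ᵀ) (conjVec X) z := by
  have hd := differentiableAt_of_contDiffOn hH.isOpen hH.smooth hz
  have hself (i j : ι) : ∀ w ∈ U, star (H w i j) = H w j i :=
    fun w hw => (hH.isHermitian w hw).apply j i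
  have hcderiv : (cderiv X H z).map star = cderiv (conjVec X) (fun w => (H w)ᵀ) z := by
    ext i j
    rw [cderiv_transpose hd, map_apply, transpose_apply, cderiv_entry hd, cderiv_entry hd,
      star_cderiv X (differentiableAt_of_contDiffOn hH.isOpen
        (contDiffOn_matrix_iff.1 hH.smooth i j) hz), cderiv_congr hH.isOpen (hself i j) hz]
  have hinv : ((H z)⁻¹).map star = ((H z)ᵀ)⁻¹ := by
    rw [← transpose_nonsing_inv]
    exact congrArg Matrix.transpose (hH.isHermitian z hz).inv
  rw [chernForm, chernForm, ← hcderiv, ← hinv]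
  exact Matrix.map_mul (f := starRingEnd ℂ)

lemma star_covDeriv {ι : Type*} [Fintype ι] {X : E × E} {A : E → Matrix ι ι ℂ} {s : E → ι → ℂ}
    (hs : DifferentiableAt ℝ s z) :
    star (covDeriv X A s z) =
      covDeriv (conjVec X) (fun w => (A w).map star) (fun w => star (s w)) z := by
  rw [covDeriv, star_add, star_cderiv X hs, star_mulVec, ← mulVec_transpose]
  rfl

namespace IsMetricOn

lemma pullbackMetric_symm {E : Type*} {F : E → RE n} {z : E} (hG : IsMetricOn G V) (hz : F z ∈ V) :
    (pullbackMetric G F z)ᵀ = pullbackMetric G F z := by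
  ext i j
  simp [pullbackMetric, hG.metric_symm hz i j]

lemma curvature_skew (hG : IsMetricOn G V) (hU : IsOpen U) (hF : ContDiffOn ℝ ∞ F U)
    (hFU : Set.MapsTo F U V) (hz : z ∈ U) (X Y : E × E) (s t : Fin n → ℂ) :
    (curvature X Y (pullbackConn G F X) (pullbackConn G F Y) z *ᵥ s) ⬝ᵥ
        pullbackMetric G F z *ᵥ t =
      -((curvature X Y (pullbackConn G F X) (pullbackConn G F Y) z *ᵥ t) ⬝ᵥ
        pullbackMetric G F z *ᵥ s) := by
  have hconn := hG.contDiffOn_pullbackConn hU hF hFU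
  have hcompat (X : E × E) := fun w (hw : w ∈ U) =>
    hG.isCompatible_pullback (differentiableAt_of_contDiffOn hU hF hw) (hFU hw) X
  have hskew := curvature_transpose_mul hU (hG.contDiffOn_pullbackMetric hF hFU) (hconn X)
    (hconn X) (hconn Y) (hconn Y) (hcompat X) (hcompat Y) hz
  rw [← vecMul_transpose, ← dotProduct_mulVec, mulVec_mulVec, hskew, neg_mulVec, dotProduct_neg,
    ← mulVec_mulVec, dotProduct_mulVec, ← mulVec_transpose, hG.pullbackMetric_symm (hFU hz),
    dotProduct_comm]

end IsMetricOn

variable {ι : Type*}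

/-- The section of `T^{*1,0} ⊗ F^* T` (in components) obtained by evaluating the complexified
differential of `F` on a frame `X` of `T^{1,0}`. -/
def frameDifferential (F : E → RE n) (X : ι → E × E) (z : E) : ι × Fin n → ℂ :=
  fun p => differential F (X p.1) z p.2

/-- The equation `∂_𝓔 ∂̄F = 0` on `U`, for the frame `X` of `T^{1,0}`. -/
def IsPluriharmonicOn (G : RE n → Matrix (Fin n) (Fin n) ℝ) (F : E → RE n) (X : ι → E × E)
    (U : Set E) : Prop :=
  ∀ z ∈ U, ∀ α β, covDeriv (X α) (pullbackConn G F (X α)) (differential F (conjVec (X β))) z = 0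

section PluriharmonicOn

variable {X : ι → E × E}

lemma IsPluriharmonicOn.covDeriv_conj (hφ : IsPluriharmonicOn G F X U) (hG : IsMetricOn G V)
    (hU : IsOpen U) (hF : ContDiffOn ℝ ∞ F U) (hFU : Set.MapsTo F U V) (hz : z ∈ U) (α β : ι) :
    covDeriv (conjVec (X β)) (pullbackConn G F (conjVec (X β))) (differential F (X α)) z = 0 := by
  rw [hG.covDeriv_differential_comm hU hF hFU hz, hφ z hz]

lemma IsPluriharmonicOn.curvature_conj_mulVec (hφ : IsPluriharmonicOn G F X U)
    (hG : IsMetricOn G V) (hU : IsOpen U) (hF : ContDiffOn ℝ ∞ F U) (hFU : Set.MapsTo F U V)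
    (hz : z ∈ U) (α β γ : ι) :
    curvature (conjVec (X β)) (conjVec (X γ)) (pullbackConn G F (conjVec (X β)))
      (pullbackConn G F (conjVec (X γ))) z *ᵥ differential F (X α) z = 0 := by
  have hconn := hG.contDiffOn_pullbackConn hU hF hFU
  have hparallel (γ : ι) := fun w hw => hφ.covDeriv_conj hG hU hF hFU (z := w) hw α γ
  rw [← covDeriv_comm hU (hconn _) (hconn _) (contDiffOn_differential hU hF _) hz,
    covDeriv_congr hU (hparallel γ) hz, covDeriv_congr hU (hparallel β) hz, covDeriv_zero,
    covDeriv_zero, sub_zero]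

lemma IsPluriharmonicOn.curvature_pairing (hφ : IsPluriharmonicOn G F X U)
    (hG : IsMetricOn G V) (hU : IsOpen U) (hF : ContDiffOn ℝ ∞ F U) (hFU : Set.MapsTo F U V)
    (hz : z ∈ U) (α β γ δ : ι) :
    (curvature (conjVec (X β)) (X α) (pullbackConn G F (conjVec (X β)))
        (pullbackConn G F (X α)) z *ᵥ differential F (X γ) z) ⬝ᵥ
        pullbackMetric G F z *ᵥ differential F (conjVec (X δ)) z =
      -∑ i, ∑ l, ∑ k, ∑ j, (riemann G i l k j (F z) : ℂ) * differential F (X α) z i *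
        differential F (conjVec (X δ)) z l * differential F (X γ) z k *
        differential F (conjVec (X β)) z j := by
  have hbianchi := hG.bianchi hU hF hFU hz (conjVec (X β)) (X α) (conjVec (X δ))
  rw [hφ.curvature_conj_mulVec hG hU hF hFU hz, add_zero] at hbianchi
  rw [hG.curvature_skew hU hF hFU hz, eq_neg_of_add_eq_zero_left hbianchi, neg_dotProduct,
    neg_neg, hG.curvature_skew hU hF hFU hz, hG.curvature_pairing hU hF hFU hz]

end PluriharmonicOn

section FrameDifferential

variable {X : ι → E × E}

lemma contDiffOn_frameDifferential [Fintype ι] (hU : IsOpen U) (hF : ContDiffOn ℝ ∞ F U)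
    (X : ι → E × E) : ContDiffOn ℝ ∞ (frameDifferential F X) U :=
  contDiffOn_pi.2 fun p => contDiffOn_pi.1 (contDiffOn_differential hU hF (X p.1)) p.2

lemma star_frameDifferential (hF : DifferentiableAt ℝ F z) :
    star (frameDifferential F X z) = frameDifferential F (fun α => conjVec (X α)) z := by
  ext ⟨γ, i⟩
  exact congrFun (star_differential hF (X γ)) i

variable [Fintype ι] [DecidableEq ι]

lemma covDeriv_frameDifferential_eq_zero {Y : E × E} {C : E → Matrix (Fin n) (Fin n) ℂ}
    (hU : IsOpen U) (hF : ContDiffOn ℝ ∞ F U) (hz : z ∈ U)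
    (h : ∀ γ, covDeriv Y C (differential F (X γ)) z = 0) :
    covDeriv Y (tensorConn 0 C) (frameDifferential F X) z = 0 := by
  ext ⟨γ, i⟩
  rw [covDeriv_tensorConn _ _
    (differentiableAt_of_contDiffOn hU (contDiffOn_frameDifferential hU hF X) hz)]
  simp only [Pi.zero_apply, Matrix.zero_apply, zero_mul, Finset.sum_const_zero, add_zero]
  exact congrFun (h γ) i

/-- The energy density `|∂F|²`, in the frame `X` of `T^{1,0}`, of a map `F` into a Riemannian
manifold. -/
def localEnergy (H : E → Matrix ι ι ℂ) (G : RE n → Matrix (Fin n) (Fin n) ℝ) (F : E → RE n)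
    (X : ι → E × E) : E → ℂ :=
  pairing (fun w => dualMetric H w ⊗ₖ pullbackMetric G F w) (frameDifferential F X)
    (frameDifferential F fun α => conjVec (X α))

/-- The covariant derivative, in the direction `X α`, of `∂F` as a section of
`T^{*1,0} ⊗ F^* T`. -/
def covDerivDel (H : E → Matrix ι ι ℂ) (G : RE n → Matrix (Fin n) (Fin n) ℝ) (F : E → RE n)
    (X : ι → E × E) (α : ι) : E → ι × Fin n → ℂ :=
  covDeriv (X α) (tensorConn (-chernForm H (X α)) (pullbackConn G F (X α)))
    (frameDifferential F X)

variable {H : E → Matrix ι ι ℂ}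

lemma localEnergy_apply (z : E) : localEnergy H G F X z =
    ∑ γ, ∑ δ, dualMetric H z γ δ * (differential F (X γ) z ⬝ᵥ
      pullbackMetric G F z *ᵥ differential F (conjVec (X δ)) z) :=
  dotProduct_kronecker_mulVec _ _ _ _

namespace IsMetricOn

lemma contDiffOn_tensorMetric (hH : IsMetricOn H U) (hG : IsMetricOn G V)
    (hF : ContDiffOn ℝ ∞ F U) (hFU : Set.MapsTo F U V) :
    ContDiffOn ℝ ∞ (fun w => dualMetric H w ⊗ₖ pullbackMetric G F w) U :=
  contDiffOn_kronecker hH.contDiffOn_dualMetric (hG.contDiffOn_pullbackMetric hF hFU)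

lemma contDiffOn_localEnergy (hH : IsMetricOn H U) (hG : IsMetricOn G V)
    (hF : ContDiffOn ℝ ∞ F U) (hFU : Set.MapsTo F U V) :
    ContDiffOn ℝ ∞ (localEnergy H G F X) U :=
  contDiffOn_pairing (hH.contDiffOn_tensorMetric hG hF hFU)
    (contDiffOn_frameDifferential hH.isOpen hF _) (contDiffOn_frameDifferential hH.isOpen hF _)

lemma im_localEnergy (hH : IsMetricOn H U) (hG : IsMetricOn G V) (hF : DifferentiableAt ℝ F z)
    (hz : z ∈ U) (hFz : F z ∈ V) : (localEnergy H G F X z).im = 0 := by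
  have hP : (pullbackMetric G F z).IsHermitian := by
    ext i j
    simp [pullbackMetric, hG.metric_symm hFz i j]
  have hK : (dualMetric H z ⊗ₖ pullbackMetric G F z).IsHermitian := by
    have hK : (dualMetric H z).IsHermitian := (hH.isHermitian z hz).inv.transpose
    rw [Matrix.IsHermitian, conjTranspose_kronecker, hP, hK]
  rw [localEnergy, pairing, ← star_frameDifferential hF]
  conv_lhs => rw [← star_star (frameDifferential F X z)]
  simpa using hK.im_star_dotProduct_mulVec_self (star (frameDifferential F X z))

lemma star_covDerivDel (hH : IsMetricOn H U) (hF : ContDiffOn ℝ ∞ F U) (hz : z ∈ U) (α : ι) :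
    star (covDerivDel H G F X α z) =
      covDeriv (conjVec (X α)) (tensorConn (-chernForm (fun w => (H w)ᵀ) (conjVec (X α)))
        (pullbackConn G F (conjVec (X α)))) (frameDifferential F fun α => conjVec (X α)) z := by
  have hdF (w : E) (hw : w ∈ U) := differentiableAt_of_contDiffOn hH.isOpen hF hw
  have hsection : ∀ w ∈ U, star (frameDifferential F X w) =
      frameDifferential F (fun α => conjVec (X α)) w := fun w hw =>
    star_frameDifferential (hdF w hw)
  have hconn : (tensorConn (-chernForm H (X α)) (pullbackConn G F (X α)) z).map star =
      tensorConn (-chernForm (fun w => (H w)ᵀ) (conjVec (X α)))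
        (pullbackConn G F (conjVec (X α))) z := by
    rw [tensorConn, tensorConn, Pi.neg_apply, Pi.neg_apply, ← hH.star_chernForm hz,
      ← star_pullbackConn (hdF z hz)]
    ext ⟨γ, i⟩ ⟨δ, j⟩
    simp [one_apply, apply_ite (starRingEnd ℂ)]
  rw [covDerivDel, star_covDeriv (differentiableAt_of_contDiffOn hH.isOpen
    (contDiffOn_frameDifferential hH.isOpen hF X) hz), covDeriv_congr hH.isOpen hsection hz,
    covDeriv, covDeriv, hconn]

lemma curvature_tensorConn_chern (hH : IsMetricOn H U) (hz : z ∈ U) {X Y : E × E}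
    {C D : E → Matrix (Fin n) (Fin n) ℂ} (hC : ContDiffOn ℝ ∞ C U) (hD : ContDiffOn ℝ ∞ D U) :
    curvature Y X (tensorConn 0 D) (tensorConn (-chernForm H X) C) z =
      (-cderiv Y (chernForm H X) z) ⊗ₖ 1 + 1 ⊗ₖ curvature Y X D C z := by
  have hneg : ContDiffOn ℝ ∞ (-chernForm H X) U := (hH.contDiffOn_chernForm X).neg
  have hzero : ContDiffOn ℝ ∞ (0 : E → Matrix ι ι ℂ) U := contDiffOn_const
  have hcurv : curvature Y X 0 (-chernForm H X) z = -cderiv Y (chernForm H X) z := by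
    have hconst : cderiv X (0 : E → Matrix ι ι ℂ) z = 0 := cderiv_const X 0 z
    simpa only [curvature, hconst, Pi.zero_apply, zero_mul, mul_zero, sub_zero, add_zero] using
      cderiv_neg Y (chernForm H X) z
  rw [curvature_tensorConn hH.isOpen hzero hneg hD hC hz, hcurv]

/-- The Bochner formula for `∂F`, which is parallel in the directions of type `(0,1)`. -/
lemma cderiv_cderiv_localEnergy (hH : IsMetricOn H U) (hG : IsMetricOn G V)
    (hF : ContDiffOn ℝ ∞ F U) (hFU : Set.MapsTo F U V) (hφ : IsPluriharmonicOn G F X U)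
    (hz : z ∈ U) (α β : ι) :
    cderiv (X α) (cderiv (conjVec (X β)) (localEnergy H G F X)) z =
      covDerivDel H G F X α z ⬝ᵥ (dualMetric H z ⊗ₖ pullbackMetric G F z) *ᵥ
        star (covDerivDel H G F X β z) +
      (((-cderiv (conjVec (X β)) (chernForm H (X α)) z) ⊗ₖ 1 +
        1 ⊗ₖ curvature (conjVec (X β)) (X α) (pullbackConn G F (conjVec (X β)))
          (pullbackConn G F (X α)) z) *ᵥ frameDifferential F X z) ⬝ᵥ
        (dualMetric H z ⊗ₖ pullbackMetric G F z) *ᵥ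
          frameDifferential F (fun α => conjVec (X α)) z := by
  have hU := hH.isOpen
  have hconn := hG.contDiffOn_pullbackConn hU hF hFU
  have hneg : ContDiffOn ℝ ∞ (-chernForm H (X α)) U := (hH.contDiffOn_chernForm (X α)).neg
  have hzero : ContDiffOn ℝ ∞ (0 : E → Matrix ι ι ℂ) U := contDiffOn_const
  have hdual (w : E) (hw : w ∈ U) :=
    differentiableAt_of_contDiffOn hU hH.contDiffOn_dualMetric hw
  have hpull (w : E) (hw : w ∈ U) :=
    differentiableAt_of_contDiffOn hU (hG.contDiffOn_pullbackMetric hF hFU) hw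
  have hcompat (Y : E × E) (w : E) (hw : w ∈ U) :=
    hG.isCompatible_pullback (differentiableAt_of_contDiffOn hU hF hw) (hFU hw) Y
  rw [hH.star_covDerivDel hF hz, ← hH.curvature_tensorConn_chern hz (hconn _) (hconn _)]
  exact cderiv_cderiv_pairing hU (hH.contDiffOn_tensorMetric hG hF hFU)
    (contDiffOn_tensorConn hneg (hconn _)) (contDiffOn_tensorConn hzero (hconn _))
    (contDiffOn_frameDifferential hU hF _) (contDiffOn_frameDifferential hU hF _)
    (fun w hw => (hH.isCompatible_chern hw _).tensor (hdual w hw) (hpull w hw) (hcompat _ w hw))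
    (fun w hw =>
      (hH.isCompatible_chern_conj hw _).tensor (hdual w hw) (hpull w hw) (hcompat _ w hw))
    (fun w hw => covDeriv_frameDifferential_eq_zero hU hF hw fun γ =>
      hφ.covDeriv_conj hG hU hF hFU hw γ β)
    (fun w hw => covDeriv_frameDifferential_eq_zero hU hF hw fun γ => hφ w hw α γ) hz

end IsMetricOn

end FrameDifferential

end Bochner

section Wirtinger

variable {m n : ℕ} {H : CE m → Matrix (Fin m) (Fin m) ℂ} {G : RE n → Matrix (Fin n) (Fin n) ℝ}
  {F : CE m → RE n} {U : Set (CE m)} {V : Set (RE n)} {z : CE m}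

/-- The `(1,0)`-part `(a - i J a) / 2` of `a`. -/
def holPart (a : CE m) : CE m × CE m :=
  ((1 / 2 : ℝ) • a, -((1 / 2 : ℝ) • Complex.I • a))

/-- The vector `∂/∂z^α = (∂/∂x^α - i ∂/∂y^α) / 2`. -/
def holVec (α : Fin m) : CE m × CE m := holPart (EuclideanSpace.single α 1)

lemma I_smul_single_one (α : Fin m) :
    Complex.I • (EuclideanSpace.single α 1 : CE m) = EuclideanSpace.single α Complex.I := by
  ext
  simp

lemma delz_eq_cderiv (α : Fin m) (φ : CE m → ℂ) : delz α φ = cderiv (holVec α) φ := by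
  ext z
  simp only [delz, cderiv, holVec, holPart, I_smul_single_one, map_smul, map_neg,
    Complex.real_smul, Complex.ofReal_div, Complex.ofReal_one, Complex.ofReal_ofNat, smul_eq_mul]
  ring

lemma delzbar_eq_cderiv (α : Fin m) (φ : CE m → ℂ) :
    delzbar α φ = cderiv (conjVec (holVec α)) φ := by
  ext z
  simp only [delzbar, cderiv, holVec, holPart, conjVec, I_smul_single_one, neg_neg, map_smul,
    Complex.real_smul, Complex.ofReal_div, Complex.ofReal_one, Complex.ofReal_ofNat, smul_eq_mul]
  ring

lemma differential_holPart_smul (F : CE m → RE n) (z a : CE m) (c : ℂ) :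
    differential F (holPart (c • a)) z = c • differential F (holPart a) z := by
  let D : CE m →L[ℝ] Fin n → ℂ := fderiv ℝ (fun w i => (F w i : ℂ)) z
  have hD (b : ℂ) : D (b • a) = b.re • D a + b.im • D (Complex.I • a) := by
    rw [← map_smul, ← map_smul, ← map_add]
    congr 1
    ext i
    simp [Complex.ext_iff, sub_eq_add_neg]
  change D ((1 / 2 : ℝ) • c • a) + Complex.I • D (-((1 / 2 : ℝ) • Complex.I • c • a)) =
    c • (D ((1 / 2 : ℝ) • a) + Complex.I • D (-((1 / 2 : ℝ) • Complex.I • a)))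
  ext i
  simp only [map_smul, map_neg, smul_smul Complex.I c a, hD c, hD (Complex.I * c),
    Complex.I_mul_re, Complex.I_mul_im, Pi.add_apply, Pi.smul_apply, Pi.neg_apply, smul_eq_mul,
    Complex.real_smul]
  conv_rhs => rw [← Complex.re_add_im c]
  push_cast
  linear_combination (c.im * D (Complex.I • a) i / 2) * Complex.I_mul_I

lemma differential_holPart (F : CE m → RE n) (z a : CE m) :
    differential F (holPart a) z = ∑ γ, a γ • differential F (holVec γ) z := by
  let L : CE m →ₗ[ℂ] Fin n → ℂ :=
    { toFun := fun a => differential F (holPart a) z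
      map_add' := fun a b => by
        simp only [differential, cderiv, holPart, smul_add, neg_add, map_add]
        abel
      map_smul' := fun c a => differential_holPart_smul F z a c }
  exact map_eq_sum_smul_single L a

lemma delF_eq_differential (hF : DifferentiableAt ℝ F z) (i : Fin n) (α : Fin m) :
    delF F i α z = differential F (holVec α) z i := by
  rw [delF, delz_eq_cderiv, differential, cderiv_apply (differentiableAt_complexCoords hF)]

lemma delbarF_eq_differential (hF : DifferentiableAt ℝ F z) (i : Fin n) (α : Fin m) :
    delbarF F i α z = differential F (conjVec (holVec α)) z i := by
  rw [delbarF, delzbar_eq_cderiv, differential, cderiv_apply (differentiableAt_complexCoords hF)]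

lemma nablaE_eq_covDeriv (hU : IsOpen U) (hF : DifferentiableAt ℝ F z) {s : CE m → Fin n → ℂ}
    {σ : Fin n → CE m → ℂ} (hs : DifferentiableAt ℝ s z) (hσ : ∀ k, ∀ w ∈ U, σ k w = s w k)
    (hz : z ∈ U) (α : Fin m) (i : Fin n) :
    nablaE G F σ α i z = covDeriv (holVec α) (pullbackConn G F (holVec α)) s z i := by
  simp only [nablaE, covDeriv, Pi.add_apply, pullbackConn_mulVec, delz_eq_cderiv,
    cderiv_congr hU (hσ i) hz, cderiv_apply hs, delF_eq_differential hF, hσ _ z hz]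

lemma targetCurvTerm_eq (hF : DifferentiableAt ℝ F z) (α β : Fin m) :
    targetCurvTerm H G F α β z = ∑ γ, ∑ δ, dualMetric H z γ δ *
      ∑ i, ∑ l, ∑ k, ∑ j, (riemann G i l k j (F z) : ℂ) * differential F (holVec α) z i *
        differential F (conjVec (holVec δ)) z l * differential F (holVec γ) z k *
        differential F (conjVec (holVec β)) z j := by
  have hswap (T : Fin n → Fin n → Fin n → Fin n → Fin m → Fin m → ℂ) :
      ∑ i, ∑ l, ∑ k, ∑ j, ∑ γ, ∑ δ, T i l k j γ δ =
        ∑ γ, ∑ δ, ∑ i, ∑ l, ∑ k, ∑ j, T i l k j γ δ := by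
    simpa only [Fintype.sum_prod_type] using Finset.sum_comm
      (s := (Finset.univ : Finset (Fin n × Fin n × Fin n × Fin n)))
      (t := (Finset.univ : Finset (Fin m × Fin m)))
      (f := fun p q => T p.1 p.2.1 p.2.2.1 p.2.2.2 q.1 q.2)
  simp only [targetCurvTerm, delF_eq_differential hF, delbarF_eq_differential hF, Finset.mul_sum,
    hswap]
  congr! 6
  simp only [dualMetric, hInv, transpose_apply]
  ring

namespace IsMetricOn

lemma chernConn_eq (hH : IsMetricOn H U) (hz : z ∈ U) (α γ μ : Fin m) :
    chernConn H μ α γ z = chernForm H (holVec α) z γ μ := by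
  simp only [chernConn, chernForm, mul_apply, hInv, delz_eq_cderiv,
    cderiv_entry (differentiableAt_of_contDiffOn hH.isOpen hH.smooth hz), mul_comm]

lemma chernCurv_eq (hH : IsMetricOn H U) (hz : z ∈ U) (α β γ δ : Fin m) :
    chernCurv H α β γ δ z =
      (-cderiv (conjVec (holVec β)) (chernForm H (holVec α)) z * H z) γ δ := by
  have hentry (μ : Fin m) : cderiv (conjVec (holVec β)) (chernConn H μ α γ) z =
      cderiv (conjVec (holVec β)) (chernForm H (holVec α)) z γ μ := by
    rw [cderiv_entry (differentiableAt_of_contDiffOn hH.isOpen (hH.contDiffOn_chernForm _) hz)]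
    exact cderiv_congr hH.isOpen (fun w hw => hH.chernConn_eq hw α γ μ) hz
  simp only [chernCurv, mul_apply, Matrix.neg_apply, delzbar_eq_cderiv, hentry, mul_comm]

variable (hH : IsMetricOn H U) (hF : ContDiffOn ℝ ∞ F U)
include hH hF

lemma nablaDelF_eq_covDerivDel (hz : z ∈ U) (α γ : Fin m) (i : Fin n) :
    nablaDelF H G F α i γ z = covDerivDel H G F holVec α z (γ, i) := by
  have hU := hH.isOpen
  have hdF (w : CE m) (hw : w ∈ U) := differentiableAt_of_contDiffOn hU hF hw
  have hsection := differentiableAt_of_contDiffOn hU (contDiffOn_frameDifferential hU hF holVec) hz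
  have hpullback := nablaE_eq_covDeriv (G := G) hU (hdF z hz)
    (differentiableAt_of_contDiffOn hU (contDiffOn_differential hU hF (holVec γ)) hz)
    (fun k w hw => delF_eq_differential (hdF w hw) k γ) hz α i
  rw [nablaDelF, nablaF, covDerivDel, covDeriv_tensorConn _ _ hsection, hpullback]
  simp only [hH.chernConn_eq hz, delF_eq_differential (hdF z hz), frameDifferential, Pi.neg_apply,
    Matrix.neg_apply, neg_mul, Finset.sum_neg_distrib, sub_eq_add_neg]

lemma gradTerm_eq (hz : z ∈ U) (α β : Fin m) :
    gradTerm H G F α β z = covDerivDel H G F holVec α z ⬝ᵥ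
      (dualMetric H z ⊗ₖ pullbackMetric G F z) *ᵥ star (covDerivDel H G F holVec β z) := by
  rw [dotProduct_kronecker_mulVec]
  simp only [gradTerm, innerF, hH.nablaDelF_eq_covDerivDel hF hz, dotProduct, mulVec,
    Finset.mul_sum]
  congr! 4
  simp only [dualMetric, hInv, pullbackMetric, transpose_apply, AlgHom.mapMatrix_apply,
    Complex.ofRealAm_coe, map_apply, Pi.star_apply, RCLike.star_def]
  ring

lemma domainCurvTerm_eq (hz : z ∈ U) (α β : Fin m) :
    domainCurvTerm H G F α β z =
      (((-cderiv (conjVec (holVec β)) (chernForm H (holVec α)) z) ⊗ₖ 1) *ᵥ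
        frameDifferential F holVec z) ⬝ᵥ (dualMetric H z ⊗ₖ pullbackMetric G F z) *ᵥ
          frameDifferential F (fun α => conjVec (holVec α)) z := by
  have hdF := differentiableAt_of_contDiffOn hH.isOpen hF hz
  have hraise (γ μ : Fin m) : ∑ δ, chernCurv H α β γ δ z * hInv H μ δ z =
      (-cderiv (conjVec (holVec β)) (chernForm H (holVec α)) z) γ μ := by
    simp only [hH.chernCurv_eq hz, hInv]
    rw [← mul_apply, mul_nonsing_inv_cancel_right _ _ (hH.isUnit_det z hz)]
  have hswap (T : Fin m → Fin m → Fin n → Fin n → ℂ) :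
      ∑ μ, ∑ δ, ∑ i, ∑ j, T μ δ i j = ∑ i, ∑ j, ∑ μ, ∑ δ, T μ δ i j := by
    simpa only [Fintype.sum_prod_type] using Finset.sum_comm
      (s := (Finset.univ : Finset (Fin m × Fin m))) (t := (Finset.univ : Finset (Fin n × Fin n)))
      (f := fun p q => T p.1 p.2 q.1 q.2)
  rw [dotProduct_kronecker_mulVec]
  simp only [kronecker_one_mulVec, ← hraise, domainCurvTerm]
  refine Finset.sum_congr rfl fun γ _ => ?_
  rw [Finset.sum_comm_cycle]
  refine Finset.sum_congr rfl fun ν _ => ?_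
  rw [Finset.sum_comm]
  simp only [dotProduct, mulVec, delF_eq_differential hdF, delbarF_eq_differential hdF,
    Finset.mul_sum, Finset.sum_mul]
  rw [hswap]
  congr! 4
  simp only [dualMetric, hInv, pullbackMetric, frameDifferential, transpose_apply,
    AlgHom.mapMatrix_apply, Complex.ofRealAm_coe, map_apply]
  ring

lemma complexHessian_localEnergy (hG : IsMetricOn G V) (hFU : Set.MapsTo F U V)
    (hφ : IsPluriharmonicOn G F holVec U) (hz : z ∈ U) (α β : Fin m) :
    delz α (delzbar β (localEnergy H G F holVec)) z =
      gradTerm H G F α β z + (domainCurvTerm H G F α β z - targetCurvTerm H G F α β z) := by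
  have hdF := differentiableAt_of_contDiffOn hH.isOpen hF hz
  rw [delz_eq_cderiv, delzbar_eq_cderiv, hH.cderiv_cderiv_localEnergy hG hF hFU hφ hz,
    add_mulVec, add_dotProduct, ← hH.gradTerm_eq hF hz, ← hH.domainCurvTerm_eq hF hz,
    targetCurvTerm_eq hdF, dotProduct_kronecker_mulVec]
  simp only [one_kronecker_mulVec, frameDifferential,
    hφ.curvature_pairing hG hH.isOpen hF hFU hz, mul_neg, Finset.sum_neg_distrib, sub_eq_add_neg]

end IsMetricOn

lemma isPluriharmonicOn_of_nablaE_delbarF (hU : IsOpen U) (hF : ContDiffOn ℝ ∞ F U)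
    (hφ : ∀ z ∈ U, ∀ α β i, nablaE G F (fun k => delbarF F k β) α i z = 0) :
    IsPluriharmonicOn G F holVec U := fun z hz α β => by
  have hdF (w : CE m) (hw : w ∈ U) := differentiableAt_of_contDiffOn hU hF hw
  ext i
  rw [← nablaE_eq_covDeriv hU (hdF z hz)
    (differentiableAt_of_contDiffOn hU (contDiffOn_differential hU hF _) hz)
    (fun k w hw => delbarF_eq_differential (hdF w hw) k β) hz, hφ z hz]
  rfl

end Wirtinger

section SesquilinearForm

variable {𝕜 : Type*} [RCLike 𝕜] {ι : Type*} [Fintype ι] [DecidableEq ι] {W : Type*}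
  [AddCommGroup W] [Module 𝕜 W] {σ : 𝕜 →+* 𝕜}

lemma apply_map_eq_dotProduct (B : W →ₗ[𝕜] W →ₛₗ[σ] 𝕜) (L : EuclideanSpace 𝕜 ι →ₗ[𝕜] W)
    (v w : EuclideanSpace 𝕜 ι) :
    B (L v) (L w) = v.ofLp ⬝ᵥ (of fun i j => B (L (EuclideanSpace.single i 1))
      (L (EuclideanSpace.single j 1))) *ᵥ fun j => σ (w j) := by
  rw [map_eq_sum_smul_single L v, map_eq_sum_smul_single L w]
  simp only [map_sum, LinearMap.sum_apply, map_smul, LinearMap.smul_apply, LinearMap.map_smulₛₗ,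
    smul_eq_mul, dotProduct, mulVec, of_apply, Finset.mul_sum]
  rw [Finset.sum_comm]
  exact Finset.sum_congr rfl fun i _ => Finset.sum_congr rfl fun j _ => by ring

lemma isUnit_det_gram (B : W →ₗ[𝕜] W →ₛₗ[σ] 𝕜) (hB : ∀ v ≠ 0, B v v ≠ 0)
    {L : EuclideanSpace 𝕜 ι →ₗ[𝕜] W} (hL : Function.Injective L) :
    IsUnit (of fun i j => B (L (EuclideanSpace.single i 1))
      (L (EuclideanSpace.single j 1))).det := by
  refine isUnit_iff_ne_zero.2 fun hdet => ?_
  obtain ⟨v, hv, hvB⟩ := exists_vecMul_eq_zero_iff.2 hdet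
  have hv' : WithLp.toLp 2 v ≠ 0 := fun h => hv (by simpa using congrArg WithLp.ofLp h)
  refine hB (L (WithLp.toLp 2 v)) ((map_ne_zero_iff L hL).2 hv') ?_
  rw [apply_map_eq_dotProduct, dotProduct_mulVec, hvB, zero_dotProduct]

lemma trace_inv_mul_basis_change {A C L R : Matrix ι ι 𝕜} (hL : IsUnit L.det)
    (hR : IsUnit R.det) : ((L * A * R)⁻¹ * (L * C * R)).trace = (A⁻¹ * C).trace := by
  rw [Matrix.mul_inv_rev, Matrix.mul_inv_rev]
  calc (R⁻¹ * (A⁻¹ * L⁻¹) * (L * C * R)).trace = (R⁻¹ * (A⁻¹ * (L⁻¹ * L) * C * R)).trace := by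
        simp only [Matrix.mul_assoc]
    _ = (R * R⁻¹ * (A⁻¹ * C)).trace := by
        rw [nonsing_inv_mul _ hL, Matrix.mul_one, trace_mul_comm, Matrix.mul_assoc,
          trace_mul_comm]
    _ = (A⁻¹ * C).trace := by rw [mul_nonsing_inv _ hR, Matrix.one_mul]

end SesquilinearForm

section Charts

variable {m n : ℕ} {M : Type*} [TopologicalSpace M] [ChartedSpace (CE m) M]
  {N : Type*} [TopologicalSpace N] [ChartedSpace (RE n) N]
  {e : OpenPartialHomeomorph M (CE m)} {ψ : OpenPartialHomeomorph N (RE n)}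

lemma contDiffGroupoid_complex_le_real :
    contDiffGroupoid ω 𝓘(ℂ, CE m) ≤ contDiffGroupoid ∞ 𝓘(ℝ, CE m) := by
  refine groupoid_of_pregroupoid_le _ _ fun f s hf => ?_
  have hanalytic : ContDiffOn ℂ ω f s := by simpa [contDiffPregroupoid] using hf
  simpa [contDiffPregroupoid] using (hanalytic.restrict_scalars ℝ).of_le le_top

lemma mem_maximalAtlas_real (he : e ∈ IsManifold.maximalAtlas 𝓘(ℂ, CE m) ω M) :
    e ∈ IsManifold.maximalAtlas 𝓘(ℝ, CE m) ∞ M :=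
  StructureGroupoid.maximalAtlas_mono contDiffGroupoid_complex_le_real he

lemma mdifferentiable_of_mem_maximalAtlas {𝕜 : Type*} [NontriviallyNormedField 𝕜] {E : Type*}
    [NormedAddCommGroup E] [NormedSpace 𝕜 E] {M : Type*} [TopologicalSpace M] [ChartedSpace E M]
    {k : ℕ∞ω} [IsManifold 𝓘(𝕜, E) k M] (hk : k ≠ 0) {e : OpenPartialHomeomorph M E}
    (he : e ∈ IsManifold.maximalAtlas 𝓘(𝕜, E) k M) : e.MDifferentiable 𝓘(𝕜, E) 𝓘(𝕜, E) :=
  ⟨(contMDiffOn_of_mem_maximalAtlas he).mdifferentiableOn hk,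
    (contMDiffOn_symm_of_mem_maximalAtlas he).mdifferentiableOn hk⟩

lemma mfderiv_symm_real_eq_complex {z : CE m}
    (hC : MDifferentiableAt 𝓘(ℂ, CE m) 𝓘(ℂ, CE m) e.symm z)
    (hR : MDifferentiableAt 𝓘(ℝ, CE m) 𝓘(ℝ, CE m) e.symm z) (v : CE m) :
    (mfderiv 𝓘(ℝ, CE m) 𝓘(ℝ, CE m) e.symm z v : CE m) =
      mfderiv 𝓘(ℂ, CE m) 𝓘(ℂ, CE m) e.symm z v := by
  have hwritten : DifferentiableAt ℂ (writtenInExtChartAt 𝓘(ℂ, CE m) 𝓘(ℂ, CE m) z e.symm) z := by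
    have hwithin := hC.differentiableWithinAt_writtenInExtChartAt
    rw [modelWithCornersSelf_coe, Set.range_id, differentiableWithinAt_univ] at hwithin
    exact hwithin
  rw [hC.mfderiv, hR.mfderiv]
  simp only [modelWithCornersSelf_coe, Set.range_id, fderivWithin_univ]
  exact congrArg (· v) (hwritten.fderiv_restrictScalars ℝ)

lemma inner_mfderiv_symm [IsManifold (𝓡 n) ∞ N] (g : RiemMetric n N)
    (ψ : OpenPartialHomeomorph N (RE n)) (y v w : RE n) :
    g.inner (ψ.symm y) (mfderiv (𝓡 n) (𝓡 n) ψ.symm y v) (mfderiv (𝓡 n) (𝓡 n) ψ.symm y w) =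
      v.ofLp ⬝ᵥ metricMatrix g ψ y *ᵥ w.ofLp :=
  apply_map_eq_dotProduct (g.inner (ψ.symm y)).toLinearMap₁₂
    (mfderiv (𝓡 n) (𝓡 n) ψ.symm y).toLinearMap v w

lemma form_mfderiv_symm [IsManifold 𝓘(ℂ, CE m) ω M] (h : HermitianMetric m M)
    (e : OpenPartialHomeomorph M (CE m)) (z v w : CE m) :
    h.form (e.symm z) (mfderiv 𝓘(ℂ, CE m) 𝓘(ℂ, CE m) e.symm z v)
      (mfderiv 𝓘(ℂ, CE m) 𝓘(ℂ, CE m) e.symm z w) = v.ofLp ⬝ᵥ h.matrix e z *ᵥ star w.ofLp :=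
  apply_map_eq_dotProduct (h.form (e.symm z)) (mfderiv 𝓘(ℂ, CE m) 𝓘(ℂ, CE m) e.symm z).toLinearMap
    v w

lemma isMetricOn_matrix [IsManifold 𝓘(ℂ, CE m) ω M] (h : HermitianMetric m M)
    (he : e ∈ IsManifold.maximalAtlas 𝓘(ℂ, CE m) ω M) : IsMetricOn (h.matrix e) e.target where
  isOpen := e.open_target
  smooth := contDiffOn_matrix_iff.2 (h.smooth e he)
  isHermitian z _ := by ext α β; exact h.symm _ _ _
  isUnit_det z hz := isUnit_det_gram (h.form (e.symm z))
    (fun v hv h0 => (h.pos _ v hv).ne' (by rw [h0, Complex.zero_re]))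
    (L := (mfderiv 𝓘(ℂ, CE m) 𝓘(ℂ, CE m) e.symm z).toLinearMap)
    ((mdifferentiable_of_mem_maximalAtlas (by simp) he).symm.mfderiv_injective hz)

lemma contDiffOn_metricMatrix [IsManifold (𝓡 n) ∞ N] (g : RiemMetric n N)
    (hψ : ψ ∈ IsManifold.maximalAtlas (𝓡 n) ∞ N) (i j : Fin n) :
    ContDiffOn ℝ ∞ (fun y => metricMatrix g ψ y i j) ψ.target := by
  have hsymm : ContMDiffOn (𝓡 n) (𝓡 n) ∞ ψ.symm ψ.target := contMDiffOn_symm_of_mem_maximalAtlas hψ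
  have hcoord (i : Fin n) : ContMDiffOn (𝓡 n) ((𝓡 n).prod 𝓘(ℝ, RE n)) ∞
      (fun y => Bundle.TotalSpace.mk' (RE n) (E := fun q : N => TangentSpace (𝓡 n) q)
        (ψ.symm y) (coordVecN ψ i y)) ψ.target := by
    have htangent := hsymm.contMDiffOn_tangentMapWithin (m := ∞) (by simp)
      ψ.open_target.uniqueMDiffOn
    have hconst : ContMDiff (𝓡 n) ((𝓡 n).prod 𝓘(ℝ, RE n)) ∞
        (fun y : RE n => Bundle.TotalSpace.mk' (RE n) (E := fun q : RE n => TangentSpace (𝓡 n) q)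
          y (EuclideanSpace.single i (1 : ℝ) : RE n)) :=
      contMDiff_vectorSpace_iff_contDiff.2 contDiff_const
    refine (htangent.comp hconst.contMDiffOn fun y hy => hy).congr fun y hy => ?_
    simp only [Function.comp, tangentMapWithin, coordVecN]
    rw [mfderivWithin_of_isOpen ψ.open_target hy]
  have hinner : ContMDiffOn (𝓡 n) ((𝓡 n).prod 𝓘(ℝ)) ∞
      (fun y => Bundle.TotalSpace.mk' ℝ (E := Bundle.Trivial N ℝ) (ψ.symm y)
        (g.inner (ψ.symm y) (coordVecN ψ i y) (coordVecN ψ j y))) ψ.target := by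
    apply ContMDiffOn.clm_bundle_apply₂ (F₁ := RE n) (F₂ := RE n)
    · exact g.contMDiff.comp_contMDiffOn hsymm
    · exact hcoord i
    · exact hcoord j
  exact contMDiffOn_iff_contDiffOn.1 fun y hy =>
    (Bundle.contMDiffWithinAt_totalSpace.1 (hinner y hy)).2

lemma isMetricOn_metricMatrix [IsManifold (𝓡 n) ∞ N] (g : RiemMetric n N)
    (hψ : ψ ∈ IsManifold.maximalAtlas (𝓡 n) ∞ N) : IsMetricOn (metricMatrix g ψ) ψ.target where
  isOpen := ψ.open_target
  smooth := contDiffOn_matrix_iff.2 (contDiffOn_metricMatrix g hψ)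
  isHermitian y _ := by ext i j; exact g.symm _ _ _
  isUnit_det y hy := isUnit_det_gram (g.inner (ψ.symm y)).toLinearMap₁₂
    (fun v hv => (g.pos _ v hv).ne')
    (L := (mfderiv (𝓡 n) (𝓡 n) ψ.symm y).toLinearMap)
    ((mdifferentiable_of_mem_maximalAtlas (by simp) hψ).symm.mfderiv_injective hy)

end Charts

section LocalDomain

variable {m n : ℕ} {M : Type*} [TopologicalSpace M] {N : Type*} [TopologicalSpace N]
  {e : OpenPartialHomeomorph M (CE m)} {ψ : OpenPartialHomeomorph N (RE n)} {f : M → N}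

/-- The domain of the coordinate expression of `f` in the charts `e` and `ψ`. -/
def localDomain (e : OpenPartialHomeomorph M (CE m)) (ψ : OpenPartialHomeomorph N (RE n))
    (f : M → N) : Set (CE m) :=
  e.target ∩ e.symm ⁻¹' (f ⁻¹' ψ.source)

lemma isOpen_localDomain (hf : Continuous f) : IsOpen (localDomain e ψ f) :=
  e.symm.isOpen_inter_preimage (ψ.open_source.preimage hf)

lemma mem_localDomain {p : M} (hp : p ∈ e.source) (hfp : f p ∈ ψ.source) :
    e p ∈ localDomain e ψ f :=
  ⟨e.map_source hp, by rwa [Set.mem_preimage, e.left_inv hp]⟩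

lemma mapsTo_localRep : Set.MapsTo (localRep e ψ f) (localDomain e ψ f) ψ.target :=
  fun _ hz => ψ.map_source hz.2

variable [ChartedSpace (CE m) M]

lemma isMetricOn_localDomain [IsManifold 𝓘(ℂ, CE m) ω M] (h : HermitianMetric m M)
    (he : e ∈ IsManifold.maximalAtlas 𝓘(ℂ, CE m) ω M) (hf : Continuous f) :
    IsMetricOn (h.matrix e) (localDomain e ψ f) :=
  (isMetricOn_matrix h he).mono (isOpen_localDomain hf) Set.inter_subset_left

variable [ChartedSpace (RE n) N]

lemma contDiffOn_localRep (he : e ∈ IsManifold.maximalAtlas 𝓘(ℂ, CE m) ω M)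
    (hψ : ψ ∈ IsManifold.maximalAtlas (𝓡 n) ∞ N) (hf : ContMDiff 𝓘(ℝ, CE m) (𝓡 n) ∞ f) :
    ContDiffOn ℝ ∞ (localRep e ψ f) (localDomain e ψ f) := by
  have hsymm : ContMDiffOn 𝓘(ℝ, CE m) 𝓘(ℝ, CE m) ∞ e.symm e.target :=
    contMDiffOn_symm_of_mem_maximalAtlas (mem_maximalAtlas_real he)
  exact ((contMDiffOn_of_mem_maximalAtlas hψ).comp
    ((hf.comp_contMDiffOn hsymm).mono Set.inter_subset_left) fun _ hz => hz.2).contDiffOn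

lemma differentiableAt_localRep (he : e ∈ IsManifold.maximalAtlas 𝓘(ℂ, CE m) ω M)
    (hψ : ψ ∈ IsManifold.maximalAtlas (𝓡 n) ∞ N) (hf : ContMDiff 𝓘(ℝ, CE m) (𝓡 n) ∞ f)
    {z : CE m} (hz : z ∈ localDomain e ψ f) : DifferentiableAt ℝ (localRep e ψ f) z :=
  differentiableAt_of_contDiffOn (isOpen_localDomain hf.continuous)
    (contDiffOn_localRep he hψ hf) hz

variable [IsManifold 𝓘(ℂ, CE m) ω M] [IsManifold (𝓡 n) ∞ N]

lemma realDiff_mfderiv_symm (he : e ∈ IsManifold.maximalAtlas 𝓘(ℂ, CE m) ω M)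
    (hψ : ψ ∈ IsManifold.maximalAtlas (𝓡 n) ∞ N) (hf : ContMDiff 𝓘(ℝ, CE m) (𝓡 n) ∞ f)
    {z : CE m} (hz : z ∈ localDomain e ψ f) (a : CE m) :
    (realDiff f (e.symm z) (mfderiv 𝓘(ℂ, CE m) 𝓘(ℂ, CE m) e.symm z a) : RE n) =
      mfderiv (𝓡 n) (𝓡 n) ψ.symm (localRep e ψ f z) (fderiv ℝ (localRep e ψ f) z a) := by
  have hC : MDifferentiableAt 𝓘(ℂ, CE m) 𝓘(ℂ, CE m) e.symm z :=
    (mdifferentiable_of_mem_maximalAtlas (by simp) he).mdifferentiableAt_symm hz.1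
  have hR : MDifferentiableAt 𝓘(ℝ, CE m) 𝓘(ℝ, CE m) e.symm z :=
    (contMDiffAt_symm_of_mem_maximalAtlas (mem_maximalAtlas_real he) hz.1).mdifferentiableAt
      (by simp)
  have hψ' : MDifferentiableAt (𝓡 n) (𝓡 n) ψ.symm (localRep e ψ f z) :=
    (mdifferentiable_of_mem_maximalAtlas (by simp) hψ).mdifferentiableAt_symm (mapsTo_localRep hz)
  have hcomp := (hf.mdifferentiable (by simp) (e.symm z)).hasMFDerivAt.comp z hR.hasMFDerivAt
  have hcomp' := hψ'.hasMFDerivAt.comp z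
    (differentiableAt_localRep he hψ hf hz).hasFDerivAt.hasMFDerivAt
  have hnhds : f ∘ e.symm =ᶠ[𝓝 z] ψ.symm ∘ localRep e ψ f :=
    Filter.eventuallyEq_of_mem ((isOpen_localDomain hf.continuous).mem_nhds hz)
      fun w hw => (ψ.left_inv hw.2).symm
  have heq := congrArg (· a) (hasMFDerivAt_unique hcomp (hcomp'.congr_of_eventuallyEq hnhds))
  refine Eq.trans ?_ heq
  change (mfderiv 𝓘(ℝ, CE m) (𝓡 n) f (e.symm z) _ : RE n) =
    mfderiv 𝓘(ℝ, CE m) (𝓡 n) f (e.symm z) (mfderiv 𝓘(ℝ, CE m) 𝓘(ℝ, CE m) e.symm z a)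
  rw [mfderiv_symm_real_eq_complex hC hR]

end LocalDomain

section Energy

variable {m n : ℕ} {N : Type*} [TopologicalSpace N] [ChartedSpace (RE n) N]

lemma gHerm_congr [IsManifold (𝓡 n) ∞ N] (g : RiemMetric n N) {q q' : N} (h : q = q')
    (a b c d : RE n) : gHerm g q a b c d = gHerm g q' a b c d := by
  subst h
  rfl

lemma gHerm_mfderiv_symm [IsManifold (𝓡 n) ∞ N] (g : RiemMetric n N)
    (ψ : OpenPartialHomeomorph N (RE n)) (y a b c d : RE n) :
    gHerm g (ψ.symm y) (mfderiv (𝓡 n) (𝓡 n) ψ.symm y a) (mfderiv (𝓡 n) (𝓡 n) ψ.symm y b)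
      (mfderiv (𝓡 n) (𝓡 n) ψ.symm y c) (mfderiv (𝓡 n) (𝓡 n) ψ.symm y d) =
      (fun i => (a i + Complex.I * b i : ℂ)) ⬝ᵥ
        complexify (metricMatrix g ψ y) *ᵥ star fun j => (c j + Complex.I * d j : ℂ) := by
  simp only [gHerm, inner_mfderiv_symm, dotProduct, mulVec, complexify, AlgHom.mapMatrix_apply,
    Complex.ofRealAm_coe, map_apply, Pi.star_apply, ← Finset.sum_add_distrib,
    ← Finset.sum_sub_distrib, Complex.ofReal_sum, Finset.mul_sum]
  refine Finset.sum_congr rfl fun i _ => Finset.sum_congr rfl fun j _ => ?_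
  simp only [star_add, star_mul', RCLike.star_def, Complex.conj_ofReal, Complex.conj_I]
  push_cast
  linear_combination ((metricMatrix g ψ y i j : ℂ) * b i * d j) * Complex.I_mul_I

lemma localEnergy_eq_trace {E : Type*} [NormedAddCommGroup E] [NormedSpace ℝ E] {ι : Type*}
    [Fintype ι] [DecidableEq ι] (H : E → Matrix ι ι ℂ) (G : RE n → Matrix (Fin n) (Fin n) ℝ)
    (F : E → RE n) (X : ι → E × E) (z : E) : localEnergy H G F X z =
      ((H z)⁻¹ * of fun γ δ => differential F (X γ) z ⬝ᵥ
        pullbackMetric G F z *ᵥ differential F (conjVec (X δ)) z).trace := by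
  rw [localEnergy_apply, Finset.sum_comm]
  rfl

variable {M : Type*} [TopologicalSpace M] [ChartedSpace (CE m) M] [IsManifold 𝓘(ℂ, CE m) ω M]
  [IsManifold (𝓡 n) ∞ N] {e : OpenPartialHomeomorph M (CE m)}
  {ψ : OpenPartialHomeomorph N (RE n)} {f : M → N}

lemma delPairing_mfderiv_symm (he : e ∈ IsManifold.maximalAtlas 𝓘(ℂ, CE m) ω M)
    (hψ : ψ ∈ IsManifold.maximalAtlas (𝓡 n) ∞ N) (g : RiemMetric n N)
    (hf : ContMDiff 𝓘(ℝ, CE m) (𝓡 n) ∞ f) {z : CE m} (hz : z ∈ localDomain e ψ f) (a b : CE m) :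
    delPairing g f (e.symm z) (mfderiv 𝓘(ℂ, CE m) 𝓘(ℂ, CE m) e.symm z a)
      (mfderiv 𝓘(ℂ, CE m) 𝓘(ℂ, CE m) e.symm z b) =
      differential (localRep e ψ f) (holPart a) z ⬝ᵥ
        pullbackMetric (metricMatrix g ψ) (localRep e ψ f) z *ᵥ
          star (differential (localRep e ψ f) (holPart b) z) := by
  let D : CE m →L[ℂ] CE m := mfderiv 𝓘(ℂ, CE m) 𝓘(ℂ, CE m) e.symm z
  let T : CE m →L[ℝ] RE n := mfderiv 𝓘(ℝ, CE m) (𝓡 n) f (e.symm z)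
  let Dψ : RE n →L[ℝ] RE n := mfderiv (𝓡 n) (𝓡 n) ψ.symm (localRep e ψ f z)
  have hT (v : CE m) : T (D v) = Dψ (fderiv ℝ (localRep e ψ f) z v) :=
    realDiff_mfderiv_symm he hψ hf hz v
  have hre (v : CE m) : (1 / 2 : ℝ) • T (D v) =
      Dψ (fderiv ℝ (localRep e ψ f) z (holPart v).1) := by
    rw [hT, holPart, map_smul, map_smul]
  have him (v : CE m) : -((1 / 2 : ℝ) • T (Complex.I • D v)) =
      Dψ (fderiv ℝ (localRep e ψ f) z (holPart v).2) := by
    rw [← map_smul D, hT, holPart, map_neg, map_neg, map_smul _ (1 / 2 : ℝ),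
      map_smul _ (1 / 2 : ℝ)]
  have hdiff (v : CE m) := funext (differential_apply (differentiableAt_localRep he hψ hf hz)
    (holPart v))
  rw [hdiff, hdiff, pullbackMetric, ← gHerm_mfderiv_symm]
  refine (gHerm_congr g (ψ.left_inv hz.2).symm _ _ _ _).trans ?_
  exact congr (congr (congr (congrArg _ (hre a)) (him a)) (hre b)) (him b)

lemma delPairing_eq_dotProduct (he : e ∈ IsManifold.maximalAtlas 𝓘(ℂ, CE m) ω M)
    (hψ : ψ ∈ IsManifold.maximalAtlas (𝓡 n) ∞ N) (g : RiemMetric n N)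
    (hf : ContMDiff 𝓘(ℝ, CE m) (𝓡 n) ∞ f) {z : CE m} (hz : z ∈ localDomain e ψ f) (a b : CE m) :
    delPairing g f (e.symm z) (mfderiv 𝓘(ℂ, CE m) 𝓘(ℂ, CE m) e.symm z a)
      (mfderiv 𝓘(ℂ, CE m) 𝓘(ℂ, CE m) e.symm z b) =
      a.ofLp ⬝ᵥ (of fun γ δ => differential (localRep e ψ f) (holVec γ) z ⬝ᵥ
        pullbackMetric (metricMatrix g ψ) (localRep e ψ f) z *ᵥ
          differential (localRep e ψ f) (conjVec (holVec δ)) z) *ᵥ star b.ofLp := by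
  rw [delPairing_mfderiv_symm he hψ g hf hz, differential_holPart _ _ a,
    differential_holPart _ _ b, star_sum, sum_dotProduct]
  refine Finset.sum_congr rfl fun γ _ => ?_
  simp only [star_smul, star_differential (differentiableAt_localRep he hψ hf hz),
    smul_dotProduct, mulVec_sum, mulVec_smul, dotProduct_sum, dotProduct_smul, smul_eq_mul]
  change _ = a γ * ∑ δ, _ * star (b δ)
  rw [Finset.mul_sum]
  exact Finset.sum_congr rfl fun δ _ => by rw [of_apply]; ring

lemma energy_eq_trace (h : HermitianMetric m M) (g : RiemMetric n N)
    (f : M → N) (p : M) : energy h g f p =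
      ((of fun γ δ => h.form p (EuclideanSpace.single γ 1 : CE m)
        (EuclideanSpace.single δ 1 : CE m))⁻¹ *
          of fun γ δ => delPairing g f p (EuclideanSpace.single γ 1 : CE m)
            (EuclideanSpace.single δ 1 : CE m)).trace.re := by
  have hbasis : ⇑(EuclideanSpace.basisFun (Fin m) ℂ).toBasis =
      fun γ => EuclideanSpace.single γ 1 := by
    ext γ
    simp
  refine congrArg Complex.re (Finset.sum_comm.trans ?_)
  exact congrArg (fun b : Fin m → CE m => ((of fun γ δ => h.form p (b γ) (b δ))⁻¹ *
    of fun γ δ => delPairing g f p (b γ) (b δ)).trace) hbasis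

lemma energy_eq_localEnergy (he : e ∈ IsManifold.maximalAtlas 𝓘(ℂ, CE m) ω M)
    (hψ : ψ ∈ IsManifold.maximalAtlas (𝓡 n) ∞ N) (h : HermitianMetric m M) (g : RiemMetric n N)
    (hf : ContMDiff 𝓘(ℝ, CE m) (𝓡 n) ∞ f) {z : CE m} (hz : z ∈ localDomain e ψ f) :
    energy h g f (e.symm z) =
      (localEnergy (h.matrix e) (metricMatrix g ψ) (localRep e ψ f) holVec z).re := by
  have hsurj := (mdifferentiable_of_mem_maximalAtlas (by simp) he).symm.mfderiv_surjective hz.1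
  have hbasis (γ : Fin m) : ∃ a : CE m, mfderiv 𝓘(ℂ, CE m) 𝓘(ℂ, CE m) e.symm z a =
      (EuclideanSpace.single γ 1 : CE m) := hsurj (EuclideanSpace.single γ 1 : CE m)
  choose a ha using hbasis
  let A : Matrix (Fin m) (Fin m) ℂ := of fun γ => (a γ).ofLp
  have hform : (of fun γ δ => h.form (e.symm z) (EuclideanSpace.single γ 1 : CE m)
      (EuclideanSpace.single δ 1 : CE m)) = A * h.matrix e z * Aᴴ := by
    ext γ δ
    rw [of_apply, ← ha, ← ha]
    exact (form_mfderiv_symm h e z _ _).trans (mul_mul_apply A _ Aᴴ γ δ).symm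
  have hdel : (of fun γ δ => delPairing g f (e.symm z) (EuclideanSpace.single γ 1 : CE m)
      (EuclideanSpace.single δ 1 : CE m)) =
      A * (of fun γ δ => differential (localRep e ψ f) (holVec γ) z ⬝ᵥ
        pullbackMetric (metricMatrix g ψ) (localRep e ψ f) z *ᵥ
          differential (localRep e ψ f) (conjVec (holVec δ)) z) * Aᴴ := by
    ext γ δ
    rw [of_apply, ← ha, ← ha]
    exact (delPairing_eq_dotProduct he hψ g hf hz _ _).trans (mul_mul_apply A _ Aᴴ γ δ).symm
  have hgram : IsUnit (A * h.matrix e z * Aᴴ).det := hform ▸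
    isUnit_det_gram (h.form (e.symm z))
      (fun v hv h0 => (h.pos _ v hv).ne' (by rw [h0, Complex.zero_re])) (L := LinearMap.id)
      Function.injective_id
  rw [det_mul, det_mul] at hgram
  rw [energy_eq_trace, localEnergy_eq_trace, hform, hdel, trace_inv_mul_basis_change
    (isUnit_of_mul_isUnit_left (isUnit_of_mul_isUnit_left hgram))
    (isUnit_of_mul_isUnit_right hgram)]

lemma contMDiff_energy (h : HermitianMetric m M) (g : RiemMetric n N)
    (hf : ContMDiff 𝓘(ℝ, CE m) (𝓡 n) ∞ f) :
    ContMDiff 𝓘(ℝ, CE m) 𝓘(ℝ, ℝ) ∞ (energy h g f) := by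
  intro p
  let e := chartAt (CE m) p
  let ψ := chartAt (RE n) (f p)
  have he : e ∈ IsManifold.maximalAtlas 𝓘(ℂ, CE m) ω M := IsManifold.chart_mem_maximalAtlas p
  have hψ : ψ ∈ IsManifold.maximalAtlas (𝓡 n) ∞ N := IsManifold.chart_mem_maximalAtlas (f p)
  have hp : p ∈ e.source := mem_chart_source _ p
  have hep : e p ∈ localDomain e ψ f := mem_localDomain hp (mem_chart_source _ (f p))
  have hU := isOpen_localDomain (e := e) (ψ := ψ) hf.continuous
  have hlocal := (isMetricOn_localDomain h he hf.continuous).contDiffOn_localEnergy (X := holVec)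
    (isMetricOn_metricMatrix g hψ) (contDiffOn_localRep he hψ hf) mapsTo_localRep
  have hre := (Complex.reCLM.contDiff.comp_contDiffOn hlocal).contDiffAt (hU.mem_nhds hep)
  have hchart : ContMDiffAt 𝓘(ℝ, CE m) 𝓘(ℝ, CE m) ∞ e p :=
    contMDiffAt_of_mem_maximalAtlas (mem_maximalAtlas_real he) hp
  refine (hre.contMDiffAt.comp p hchart).congr_of_eventuallyEq ?_
  filter_upwards [(e.isOpen_inter_preimage hU).mem_nhds ⟨hp, hep⟩] with q hq
  exact (congrArg (energy h g f) (e.left_inv hq.1)).symm.trans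
    (energy_eq_localEnergy he hψ h g hf hq.2)

lemma complexHessian_energy (h : HermitianMetric m M) (g : RiemMetric n N)
    (hf : ContMDiff 𝓘(ℝ, CE m) (𝓡 n) ∞ f) (hph : IsPluriharmonic (m := m) (n := n) g f)
    (he : e ∈ IsManifold.maximalAtlas 𝓘(ℂ, CE m) ω M)
    (hψ : ψ ∈ IsManifold.maximalAtlas (𝓡 n) ∞ N) {p : M} (hp : p ∈ e.source)
    (hfp : f p ∈ ψ.source) (α β : Fin m) :
    complexHessian e (energy h g f) α β (e p) =
      gradTerm (h.matrix e) (metricMatrix g ψ) (localRep e ψ f) α β (e p) +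
      (domainCurvTerm (h.matrix e) (metricMatrix g ψ) (localRep e ψ f) α β (e p) -
        targetCurvTerm (h.matrix e) (metricMatrix g ψ) (localRep e ψ f) α β (e p)) := by
  have hU := isOpen_localDomain (e := e) (ψ := ψ) hf.continuous
  have hF := contDiffOn_localRep he hψ hf
  have hH := isMetricOn_localDomain (ψ := ψ) h he hf.continuous
  have hG := isMetricOn_metricMatrix g hψ
  have hlocal : IsPluriharmonicOn (metricMatrix g ψ) (localRep e ψ f) holVec
      (localDomain e ψ f) := by
    refine isPluriharmonicOn_of_nablaE_delbarF hU hF fun z hz α β i => ?_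
    simpa only [e.right_inv hz.1] using
      hph e he ψ hψ (e.symm z) (e.map_target hz.1) hz.2 α β i
  have henergy : ∀ z ∈ localDomain e ψ f, ((energy h g f (e.symm z) : ℝ) : ℂ) =
      localEnergy (h.matrix e) (metricMatrix g ψ) (localRep e ψ f) holVec z := fun z hz => by
    rw [energy_eq_localEnergy he hψ h g hf hz]
    exact Complex.ext rfl (hH.im_localEnergy hG (differentiableAt_localRep he hψ hf hz) hz
      (mapsTo_localRep hz)).symm
  rw [← hH.complexHessian_localEnergy hF hG mapsTo_localRep hlocal (mem_localDomain hp hfp)]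
  simp only [complexHessian, delz_eq_cderiv, delzbar_eq_cderiv]
  exact cderiv_congr hU (fun z hz => cderiv_congr hU henergy hz) (mem_localDomain hp hfp)

end Energy

end ChernLu

end

theorem proposition1p7 {m n : ℕ}
    {M : Type*} [TopologicalSpace M] [ChartedSpace (ChernLu.CE m) M]
    [IsManifold 𝓘(ℂ, ChernLu.CE m) ω M]
    {N : Type*} [TopologicalSpace N] [ChartedSpace (ChernLu.RE n) N] [IsManifold (𝓡 n) ∞ N]
    (h : ChernLu.HermitianMetric m M) (g : ChernLu.RiemMetric n N)
    (f : M → N) (hf : ContMDiff 𝓘(ℝ, ChernLu.CE m) (𝓡 n) ∞ f)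
    (hph : ChernLu.IsPluriharmonic (m := m) (n := n) g f) :
    ContMDiff 𝓘(ℝ, ChernLu.CE m) 𝓘(ℝ, ℝ) ∞ (ChernLu.energy h g f) ∧
    ∀ e ∈ IsManifold.maximalAtlas 𝓘(ℂ, ChernLu.CE m) ω M,
    ∀ ψ ∈ IsManifold.maximalAtlas (𝓡 n) ∞ N,
    ∀ p ∈ e.source, f p ∈ ψ.source →
      (∀ v w : TangentSpace 𝓘(ℂ, ChernLu.CE m) p,
        ChernLu.ddbar e (ChernLu.energy h g f) p v w =
          ChernLu.form11 e p (fun α β => ChernLu.gradTerm (h.matrix e)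
            (ChernLu.metricMatrix g ψ) (ChernLu.localRep e ψ f) α β (e p)) v w +
          ChernLu.form11 e p (fun α β =>
            ChernLu.domainCurvTerm (h.matrix e)
              (ChernLu.metricMatrix g ψ) (ChernLu.localRep e ψ f) α β (e p) -
            ChernLu.targetCurvTerm (h.matrix e)
              (ChernLu.metricMatrix g ψ) (ChernLu.localRep e ψ f) α β (e p)) v w) ∧
      ChernLu.laplacian h e (ChernLu.energy h g f) p =
        ChernLu.tr11 (h.matrix e) (ChernLu.gradTerm (h.matrix e)
          (ChernLu.metricMatrix g ψ) (ChernLu.localRep e ψ f)) (e p) +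
        ChernLu.tr11 (h.matrix e) (ChernLu.domainCurvTerm (h.matrix e)
          (ChernLu.metricMatrix g ψ) (ChernLu.localRep e ψ f)) (e p) -
        ChernLu.tr11 (h.matrix e) (ChernLu.targetCurvTerm (h.matrix e)
          (ChernLu.metricMatrix g ψ) (ChernLu.localRep e ψ f)) (e p) := by
  refine ⟨ChernLu.contMDiff_energy h g hf, fun e he ψ hψ p hp hfp => ⟨fun v w => ?_, ?_⟩⟩
  · simp only [ChernLu.ddbar, ChernLu.form11,
      ChernLu.complexHessian_energy h g hf hph he hψ hp hfp, add_mul, Finset.sum_add_distrib]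
  · simp only [ChernLu.laplacian, ChernLu.tr11,
      ChernLu.complexHessian_energy h g hf hph he hψ hp hfp, ← Finset.sum_add_distrib,
      ← Finset.sum_sub_distrib]
    exact Finset.sum_congr rfl fun α _ => Finset.sum_congr rfl fun β _ => by ring
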